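/- Let $n\ge 0$ be an integer and $R=\mathbb{Z}[x]$. The Temperley--Lieb algebra $\mathcal{A}_n(x)$ is the unital associative $R$-algebra generated by $e_1,\dots,e_{n-1}$ subject to $e_i^2=xe_i$, $e_ie_{i\pm1}e_i=e_i$, and $e_ie_j=e_je_i$ for $|i-j|\ge 2$ (for all indices for which the elements are defined). A \emph{partition} of $n$ is a pair $\lambda=(i,n-2i)$ of integers with $0\le 2i\le n$. For partitions $\lambda=(i,n-2i)$, $\mu=(j,n-2j)$ of $n$ write $\mu\rhd\lambda$ if $j>i$. For a partition $\mu$ of $n-1$ and a partition $\lambda=(i,n-2i)$ of $n$ write $\mu\to\lambda$ if $\mu=(i,n-2i-1)$ or $\mu=(i-1,n-2i+1)$. An up--down tableau of shape $\lambda$ is a sequence $\mathfrak{t}=(\lambda^{(0)},\dots,\lambda^{(n)})$, with $\lambda^{(k)}$ a partition of $k$, such that $\lambda^{(0)}=(0,0)$, $\lambda^{(k-1)}\to\lambda^{(k)}$ for $1\le k\le n$, and $\lambda^{(n)}=\lambda$; the set of these is $\mathfrak{T}_n(\lambda)$. For $1\le i,j\le n$ let $w_{i,j}=e_ie_{i+1}\cdots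 e_{j-1}$ if $i<j$, $w_{i,j}=e_{i-1}e_{i-2}\cdots e_j$ if $j<i$, and $w_{i,i}=1$. For $\mathfrak{t}=(\lambda^{(0)},\dots,\lambda^{(n)})\in\mathfrak{T}_n(\lambda)$ with $\lambda^{(k)}=(f_k,k-2f_k)$ define elements of $\mathcal{A}_n(x)$ by $v_0=v_0^*=1$ and, for $1\le k\le n$, $v_k=v_{k-1}$ and $v_k^*=v_{k-1}^*$ if $f_k=f_{k-1}$, while $v_k=w_{2f_k,k}v_{k-1}$ and $v_k^*=v_{k-1}^*w_{k,2f_k}$ if $f_k=f_{k-1}+1$; put $v_\mathfrak{t}=v_n$ and $v_\mathfrak{t}^*=v_n^*$. For $\lambda=(f,n-2f)$ let $m_\lambda=e_1e_3\cdots e_{2f-1}$, and for $\mathfrak{u},\mathfrak{v}\in\mathfrak{T}_n(\lambda)$ let $m_{\mathfrak{uv}}=v_\mathfrak{u}^*m_\lambda v_\mathfrak{v}$. Let $\mathcal{A}_n^\lambda$ be the two-sided ideal of $\mathcal{A}_n(x)$ generated by $m_\lambda$, and $\check{\mathcal{A}}_n^\lambda=\sum_{\mu\rhd\lambda}\mathcal{A}_n^\mu$.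 For an integer $f\ge 0$ and a partition $\mu$ of $n$ let $\mathfrak{T}_n^{(f)}(\mu)$ be the set of $\mathfrak{s}\in\mathfrak{T}_n(\mu)$ such that $v_\mathfrak{s}$ lies in the unital subalgebra generated by $e_{2f+1},\dots,e_{n-1}$. Then the family $(m_{\mathfrak{uv}})$, for $\mathfrak{u},\mathfrak{v}\in\mathfrak{T}_n(\lambda)$ and $\lambda$ a partition of $n$, is a free $R$-basis of $\mathcal{A}_n(x)$. Moreover: 1. The $R$-linear map $*$ determined by $m_{\mathfrak{uv}}\mapsto m_{\mathfrak{vu}}$, for all $\mathfrak{u},\mathfrak{v}\in\mathfrak{T}_n(\lambda)$ and all partitions $\lambda$ of $n$, is the unique $R$-algebra anti-involution of $\mathcal{A}_n(x)$ with $e_i\mapsto e_i$ for $i=1,\dots,n-1$. 2. For every $b\in\mathcal{A}_n(x)$, every partition $\lambda$ of $n$ and every $\mathfrak{u}\in\mathfrak{T}_n(\lambda)$ there exist $a_\mathfrak{v}\in R$, for $\mathfrak{v}\in\mathfrak{T}_n(\lambda)$, such that, for all $\mathfrak{s}\in\mathfrak{T}_n(\lambda)$, $$m_{\mathfrak{su}}b\equiv\sum_{\mathfrak{v}\in\mathfrak{T}_n(\lambda)}a_\mathfrak{v}m_{\mathfrak{sv}}\mod\check{\mathcal{A}}_n^\lambda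 .$$ 3. For every partition $\lambda$ of $n$, $\check{\mathcal{A}}_n^\lambda$ is the $R$-span of the basis elements $m_{\mathfrak{uv}}$ with $\mathfrak{u},\mathfrak{v}\in\mathfrak{T}_n(\mu)$ and $\mu\rhd\lambda$. 4. For every $b\in\mathcal{A}_n(x)$, every partition $\lambda=(f,n-2f)$ of $n$ and every $\mathfrak{u}\in\mathfrak{T}_n(\lambda)$ there exist $a_\mathfrak{v}\in R$, for $\mathfrak{v}\in\mathfrak{T}_n(\lambda)$, and $a_{\mathfrak{rt}}\in R$, for $\mathfrak{r}\in\mathfrak{T}_n^{(f)}(\mu)$, $\mathfrak{t}\in\mathfrak{T}_n(\mu)$ and $\mu\rhd\lambda$, such that $$m_\lambda v_\mathfrak{u}b=\sum_{\mathfrak{v}\in\mathfrak{T}_n(\lambda)}a_\mathfrak{v}m_\lambda v_\mathfrak{v}+\sum_{\mu\rhd\lambda}\ \sum_{\mathfrak{r}\in\mathfrak{T}_n^{(f)}(\mu),\ \mathfrak{t}\in\mathfrak{T}_n(\mu)}a_{\mathfrak{rt}}m_{\mathfrak{rt}} .$$ -/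

import Mathlib

open Polynomial

namespace TemperleyLieb

/-- The index set `{1, …, n - 1}` of the generators of the `n`-th Temperley–Lieb algebra. -/
abbrev Idx (n : ℕ) : Type := {i : ℕ // 1 ≤ i ∧ i < n}

/-- The defining relations of the Temperley–Lieb algebra over `ℤ[x]`. -/
inductive Rel (n : ℕ) : FreeAlgebra ℤ[X] (Idx n) → FreeAlgebra ℤ[X] (Idx n) → Prop
  | sq (i : Idx n) :
      Rel n (FreeAlgebra.ι ℤ[X] i * FreeAlgebra.ι ℤ[X] i) ((X : ℤ[X]) • FreeAlgebra.ι ℤ[X] i)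
  | adj (i j : Idx n) (h : j.1 = i.1 + 1 ∨ i.1 = j.1 + 1) :
      Rel n (FreeAlgebra.ι ℤ[X] i * FreeAlgebra.ι ℤ[X] j * FreeAlgebra.ι ℤ[X] i)
        (FreeAlgebra.ι ℤ[X] i)
  | comm (i j : Idx n) (h : i.1 + 2 ≤ j.1 ∨ j.1 + 2 ≤ i.1) :
      Rel n (FreeAlgebra.ι ℤ[X] i * FreeAlgebra.ι ℤ[X] j)
        (FreeAlgebra.ι ℤ[X] j * FreeAlgebra.ι ℤ[X] i)

/-- The Temperley–Lieb algebra `A_n(x)` over `R = ℤ[x]`, by generators and relations. -/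
abbrev TL (n : ℕ) : Type := RingQuot (Rel n)

/-- The generator `e_i` of `A_n(x)` for `1 ≤ i ≤ n - 1` (and `0` for all other `i`, a value that
never enters any of the words below). -/
noncomputable def e (n i : ℕ) : TL n :=
  if h : 1 ≤ i ∧ i < n then RingQuot.mkAlgHom ℤ[X] (Rel n) (FreeAlgebra.ι ℤ[X] ⟨i, h⟩) else 0

/-- `w_{i,j} = e_i e_{i+1} ⋯ e_{j-1}` if `i < j`, `e_{i-1} e_{i-2} ⋯ e_j` if `j < i`, and `1` if
`i = j`. -/
noncomputable def w (n i j : ℕ) : TL n :=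
  if i < j then ((List.range' i (j - i)).map (e n)).prod
  else if j < i then ((List.range' j (i - j)).reverse.map (e n)).prod
  else 1

/-- A partition of `n` is a pair `(i, n - 2i)` with `0 ≤ 2i ≤ n`. -/
abbrev Partn (n : ℕ) : Type := {p : ℕ × ℕ // 2 * p.1 + p.2 = n}

instance (n : ℕ) : Finite (Partn n) :=
  Finite.of_injective (β := Fin (n + 1)) (fun p => ⟨p.1.1, by have := p.2; omega⟩) (by
    rintro ⟨⟨a, b⟩, h⟩ ⟨⟨c, d⟩, h'⟩ hac
    simp only [Fin.mk.injEq] at hac h h'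
    subst hac
    have : b = d := by omega
    subst this
    rfl)

noncomputable instance (n : ℕ) : Fintype (Partn n) := Fintype.ofFinite _

/-- `Dom lam mu` is `lam ⊵ mu`. -/
def Dom {n : ℕ} (lam mu : Partn n) : Prop := mu.1.1 ≤ lam.1.1

/-- `SDom lam mu` is `lam ▷ mu`. -/
def SDom {n : ℕ} (lam mu : Partn n) : Prop := Dom lam mu ∧ lam ≠ mu

/-- `mu → lam`, for partitions `mu` of `k` and `lam = (i, k + 1 - 2i)` of `k + 1`:
either `mu = (i, k - 2i)` or `mu = (i - 1, k + 2 - 2i)`. -/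
def Arrow {k : ℕ} (mu : Partn k) (lam : Partn (k + 1)) : Prop :=
  (mu.1.1 = lam.1.1 ∧ mu.1.2 + 1 = lam.1.2) ∨ (mu.1.1 + 1 = lam.1.1 ∧ mu.1.2 = lam.1.2 + 1)

/-- The up-down tableaux of shape `lam`: sequences `(λ⁽⁰⁾, …, λ⁽ⁿ⁾)`, with `λ⁽ᵏ⁾` a partition
of `k`, that start at `(0, 0)`, end at `lam`, and satisfy `λ⁽ᵏ⁻¹⁾ → λ⁽ᵏ⁾`. -/
@[ext]
structure Tab (n : ℕ) (lam : Partn n) where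
  seq : (k : ℕ) → k ≤ n → Partn k
  start : seq 0 (Nat.zero_le n) = ⟨(0, 0), rfl⟩
  step : ∀ (k : ℕ) (hk : k + 1 ≤ n), Arrow (seq k (Nat.le_of_succ_le hk)) (seq (k + 1) hk)
  last : seq n le_rfl = lam

instance (n : ℕ) (lam : Partn n) : Finite (Tab n lam) :=
  Finite.of_injective (β := (k : Fin (n + 1)) → Partn k.1)
    (fun t k => t.seq k.1 (Nat.le_of_lt_succ k.2)) (by
      intro s t h
      ext1
      funext k hk
      exact congrFun h ⟨k, Nat.lt_succ_of_le hk⟩)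

noncomputable instance (n : ℕ) (lam : Partn n) : Fintype (Tab n lam) := Fintype.ofFinite _

/-- `v_{t|_k}`, as an element of `A_n(x)`, by recursion on `k`. -/
noncomputable def vRes {n : ℕ} {lam : Partn n} (t : Tab n lam) : (k : ℕ) → k ≤ n → TL n
  | 0, _ => 1
  | k + 1, h =>
    if (t.seq k (Nat.le_of_succ_le h)).1.1 = (t.seq (k + 1) h).1.1 then
      vRes t k (Nat.le_of_succ_le h)
    else
      w n (2 * (t.seq (k + 1) h).1.1) (k + 1) * vRes t k (Nat.le_of_succ_le h)

/-- `v_{t|_k}^*`, as an element of `A_n(x)`, by recursion on `k`. -/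
noncomputable def vStarRes {n : ℕ} {lam : Partn n} (t : Tab n lam) : (k : ℕ) → k ≤ n → TL n
  | 0, _ => 1
  | k + 1, h =>
    if (t.seq k (Nat.le_of_succ_le h)).1.1 = (t.seq (k + 1) h).1.1 then
      vStarRes t k (Nat.le_of_succ_le h)
    else
      vStarRes t k (Nat.le_of_succ_le h) * w n (k + 1) (2 * (t.seq (k + 1) h).1.1)

/-- The element `v_t`. -/
noncomputable def v {n : ℕ} {lam : Partn n} (t : Tab n lam) : TL n := vRes t n le_rfl

/-- The element `v_t^*`. -/
noncomputable def vStar {n : ℕ} {lam : Partn n} (t : Tab n lam) : TL n := vStarRes t n le_rfl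

/-- `m_λ = e_1 e_3 ⋯ e_{2f-1}` for `λ = (f, n - 2f)`. -/
noncomputable def mShape {n : ℕ} (lam : Partn n) : TL n :=
  ((List.range lam.1.1).map fun i => e n (2 * i + 1)).prod

/-- `m_{uv} = v_u^* m_λ v_v`. -/
noncomputable def m {n : ℕ} {lam : Partn n} (s t : Tab n lam) : TL n :=
  vStar s * mShape lam * v t

/-- The set of triples `(λ, u, v)` with `u, v` up-down tableaux of shape `λ`. -/
abbrev Pairs (n : ℕ) : Type := Σ lam : Partn n, Tab n lam × Tab n lam

/-- The family `(m_{uv})` indexed by all pairs of up-down tableaux of the same shape. -/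
noncomputable def mFam (n : ℕ) (p : Pairs n) : TL n := m p.2.1 p.2.2

/-- The two-sided ideal `A_n^λ` generated by `m_λ`. -/
noncomputable def idealOf {n : ℕ} (lam : Partn n) : TwoSidedIdeal (TL n) :=
  TwoSidedIdeal.span {mShape lam}

/-- The two-sided ideal `Ǎ_n^λ`, the sum of the `A_n^μ` over `μ ▷ λ`. -/
noncomputable def idealCheck {n : ℕ} (lam : Partn n) : TwoSidedIdeal (TL n) :=
  ⨆ (mu : Partn n) (_ : SDom mu lam), idealOf mu

/-- `T_n^{(f)}(μ)`: the tableaux `s` of shape `μ` such that `v_s` lies in the subalgebra generated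
by `e_{2f+1}, …, e_{n-1}`. -/
def tabAbove {n : ℕ} (f : ℕ) (mu : Partn n) : Set (Tab n mu) :=
  {s | v s ∈ Algebra.adjoin ℤ[X] {a : TL n | ∃ i : ℕ, 2 * f + 1 ≤ i ∧ i < n ∧ a = e n i}}

/-- An `R`-linear map that is an algebra anti-involution. -/
structure IsAntiInvolution {n : ℕ} (φ : TL n →ₗ[ℤ[X]] TL n) : Prop where
  map_one : φ 1 = 1
  map_mul : ∀ a b, φ (a * b) = φ b * φ a
  invol : ∀ a, φ (φ a) = a

end TemperleyLieb

namespace TemperleyLieb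

/-! An up-down tableau is recorded by its closing positions `k₁ < k₂ < ⋯ < k_f`, the steps at which
the first component grows; the only constraint is `2j ≤ k_j ≤ n`. Writing `[a, k]` for `e_a ⋯
e_{k-1}`, the element `m_λ v_t` becomes `⋯ [3, k₂] [1, k₁]` (`pWord`), and `m_{st}` becomes `qWord`
of the two lists of closing positions.

Spanning. A generator multiplied on the right of a `pWord` either yields a scalar multiple of a word
of the same length, or travels through all segments and emerges on the left as some `e_j` with `j ≥
2f + 1` (`pWord_mul_e`). In the second case `e_j = [2f+2, j+1]^* [2f+1, j+1]`, so the product is the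
word in which `j + 1` is appended to both lists (`qWord_mul_e`), which belongs to a higher shape.
The new lists may be unsorted, but an exchange relation sorts them without changing the word
(`exists_sorted`). Hence the `m_{st}` of shapes above a bound span a right ideal, and by the
anti-involution a two-sided one. The left list is only ever extended at its end, so an initial
stretch `2, 4, …, 2f` of it survives; this gives the strengthened multiplication rule, from which
the rule modulo higher shapes follows on multiplying by `v_s^*`.

Independence. The algebra acts on functions of spin configurations, with `e_i` acting as a cup after
a cap and `x = q² + q⁻²`. There `m_{st}` acts as a product of cups read off from `s` times a product
of caps read off from `t` (`spinRep_qWord`). Each tableau has a configuration with `true` exactly at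
its closing positions. For the order comparing numbers of `true` in prefixes, the matrix
coefficients of the `m_{st}` at these configurations are triangular with nonzero diagonal
(`prefixLE_of_coeffAt_ne_zero`, `coeffAt_self`), so no linear relation exists. -/

variable {n : ℕ}

/-! ### Generators, relations and the anti-involution -/

theorem e_of_mem {i : ℕ} (h : 1 ≤ i ∧ i < n) :
    e n i = RingQuot.mkAlgHom ℤ[X] (Rel n) (FreeAlgebra.ι ℤ[X] ⟨i, h⟩) := dif_pos h

theorem e_of_not_mem {i : ℕ} (h : ¬(1 ≤ i ∧ i < n)) : e n i = 0 := dif_neg h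

theorem e_mul_self (i : ℕ) : e n i * e n i = (X : ℤ[X]) • e n i := by
  by_cases h : 1 ≤ i ∧ i < n
  · rw [e_of_mem h, ← map_mul, ← map_smul]
    exact RingQuot.mkAlgHom_rel _ (Rel.sq _)
  · simp [e_of_not_mem h]

theorem e_mul_e_mul_e {i j : ℕ} (hi : 1 ≤ i ∧ i < n) (hj : 1 ≤ j ∧ j < n)
    (h : j = i + 1 ∨ i = j + 1) : e n i * e n j * e n i = e n i := by
  rw [e_of_mem hi, e_of_mem hj, ← map_mul, ← map_mul]
  exact RingQuot.mkAlgHom_rel _ (Rel.adj _ _ h)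

theorem commute_e {i j : ℕ} (h : i + 2 ≤ j ∨ j + 2 ≤ i) : Commute (e n i) (e n j) := by
  by_cases hi : 1 ≤ i ∧ i < n
  · by_cases hj : 1 ≤ j ∧ j < n
    · rw [e_of_mem hi, e_of_mem hj, commute_iff_eq, ← map_mul, ← map_mul]
      exact RingQuot.mkAlgHom_rel _ (Rel.comm _ _ h)
    · simp [e_of_not_mem hj]
  · simp [e_of_not_mem hi]

/-- A property of elements of `A_n(x)` holds if it holds for scalars and generators and is
stable under sums and products. -/
theorem TL_induction {p : TL n → Prop} (hs : ∀ r : ℤ[X], p (algebraMap ℤ[X] (TL n) r))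
    (he : ∀ i, 1 ≤ i → i < n → p (e n i)) (hm : ∀ a b, p a → p b → p (a * b))
    (ha : ∀ a b, p a → p b → p (a + b)) (a : TL n) : p a := by
  obtain ⟨a, rfl⟩ := RingQuot.mkAlgHom_surjective ℤ[X] (Rel n) a
  induction a using FreeAlgebra.induction with
  | grade0 r => rw [AlgHom.commutes]; exact hs r
  | grade1 i => rw [← e_of_mem i.2]; exact he _ i.2.1 i.2.2
  | mul a b h1 h2 => rw [map_mul]; exact hm _ _ h1 h2
  | add a b h1 h2 => rw [map_add]; exact ha _ _ h1 h2

/-- A submodule stable under right multiplication by the generators is a right ideal. -/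
theorem mul_mem_of_mul_e_mem {M : Submodule ℤ[X] (TL n)}
    (h : ∀ i, 1 ≤ i → i < n → ∀ a ∈ M, a * e n i ∈ M) (b : TL n) : ∀ a ∈ M, a * b ∈ M := by
  induction b using TL_induction with
  | hs r =>
    intro a ha
    rw [← Algebra.commutes, ← Algebra.smul_def]
    exact M.smul_mem _ ha
  | he i h1 h2 => exact h i h1 h2
  | hm b c hb hc => intro a ha; rw [← mul_assoc]; exact hc _ (hb _ ha)
  | ha b c hb hc => intro a ha; rw [mul_add]; exact M.add_mem (hb _ ha) (hc _ ha)

/-- The anti-automorphism fixing the generators, as a homomorphism to the opposite algebra. -/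
noncomputable def starHom (n : ℕ) : TL n →ₐ[ℤ[X]] (TL n)ᵐᵒᵖ :=
  RingQuot.liftAlgHom ℤ[X] ⟨FreeAlgebra.lift ℤ[X] fun i : Idx n => MulOpposite.op (e n i.1), by
    intro a b hab
    induction hab with
    | sq i =>
      simp only [map_mul, map_smul, FreeAlgebra.lift_ι_apply]
      rw [← MulOpposite.op_mul, e_mul_self, MulOpposite.op_smul]
    | adj i j h =>
      simp only [map_mul, FreeAlgebra.lift_ι_apply]
      rw [← MulOpposite.op_mul, ← MulOpposite.op_mul, ← mul_assoc, e_mul_e_mul_e i.2 j.2 h]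
    | comm i j h =>
      simp only [map_mul, FreeAlgebra.lift_ι_apply]
      rw [← MulOpposite.op_mul, ← MulOpposite.op_mul, (commute_e h).eq]⟩

/-- The `R`-linear anti-involution of `A_n(x)` fixing the generators. -/
noncomputable def tlStar (n : ℕ) : TL n →ₗ[ℤ[X]] TL n :=
  (MulOpposite.opLinearEquiv ℤ[X]).symm.toLinearMap ∘ₗ (starHom n).toLinearMap

theorem tlStar_apply (a : TL n) : tlStar n a = (starHom n a).unop := rfl

theorem tlStar_one : tlStar n 1 = 1 := by simp [tlStar_apply]

theorem tlStar_mul (a b : TL n) : tlStar n (a * b) = tlStar n b * tlStar n a := by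
  simp [tlStar_apply]

theorem tlStar_e (i : ℕ) : tlStar n (e n i) = e n i := by
  by_cases h : 1 ≤ i ∧ i < n
  · rw [e_of_mem h, tlStar_apply, starHom, RingQuot.liftAlgHom_mkAlgHom_apply,
      FreeAlgebra.lift_ι_apply, ← e_of_mem h, MulOpposite.unop_op]
  · simp [e_of_not_mem h]

theorem tlStar_algebraMap (r : ℤ[X]) :
    tlStar n (algebraMap ℤ[X] (TL n) r) = algebraMap ℤ[X] (TL n) r := by
  rw [Algebra.algebraMap_eq_smul_one, map_smul, tlStar_one]

theorem tlStar_tlStar (a : TL n) : tlStar n (tlStar n a) = a := by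
  induction a using TL_induction with
  | hs r => simp only [tlStar_algebraMap]
  | he i h1 h2 => simp only [tlStar_e]
  | hm a b ha hb => rw [tlStar_mul, tlStar_mul, ha, hb]
  | ha a b ha hb => rw [map_add, map_add, ha, hb]

theorem isAntiInvolution_tlStar (n : ℕ) : IsAntiInvolution (tlStar n) :=
  ⟨tlStar_one, tlStar_mul, tlStar_tlStar⟩

theorem IsAntiInvolution.eq_tlStar {φ : TL n →ₗ[ℤ[X]] TL n} (hφ : IsAntiInvolution φ)
    (he : ∀ i, 1 ≤ i → i < n → φ (e n i) = e n i) : φ = tlStar n := by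
  ext a
  induction a using TL_induction with
  | hs r => rw [tlStar_algebraMap, Algebra.algebraMap_eq_smul_one, map_smul, hφ.map_one]
  | he i h1 h2 => rw [tlStar_e, he i h1 h2]
  | hm a b ha hb => rw [tlStar_mul, hφ.map_mul, ha, hb]
  | ha a b ha hb => rw [map_add, map_add, ha, hb]

/-! ### Products of consecutive generators -/

/-- The product `e_a e_{a+1} ⋯ e_{c-1}`. -/
noncomputable def seg (n a c : ℕ) : TL n := ((List.range' a (c - a)).map (e n)).prod

theorem seg_of_le {a c : ℕ} (h : c ≤ a) : seg n a c = 1 := by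
  simp [seg, Nat.sub_eq_zero_of_le h]

theorem e_mul_seg {a c : ℕ} (h : a < c) : e n a * seg n (a + 1) c = seg n a c := by
  obtain ⟨d, rfl⟩ : ∃ d, c = a + d + 1 := ⟨c - a - 1, by omega⟩
  rw [seg, seg, show a + d + 1 - a = d + 1 by omega, show a + d + 1 - (a + 1) = d by omega,
    List.range'_succ, List.map_cons, List.prod_cons]

theorem seg_mul_seg {a b c : ℕ} (h : a ≤ b) (h' : b ≤ c) :
    seg n a b * seg n b c = seg n a c := by
  obtain ⟨d, rfl⟩ := Nat.exists_eq_add_of_le h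
  obtain ⟨d', rfl⟩ := Nat.exists_eq_add_of_le h'
  rw [seg, seg, seg, ← List.prod_append, ← List.map_append,
    show a + d + d' - (a + d) = d' by omega, show a + d - a = d by omega,
    show a + d + d' - a = d + d' by omega, List.range'_append_1]

theorem seg_self_succ (a : ℕ) : seg n a (a + 1) = e n a := by
  rw [← e_mul_seg (Nat.lt_succ_self a), seg_of_le le_rfl, mul_one]

theorem seg_mul_e {a c : ℕ} (h : a ≤ c) : seg n a c * e n c = seg n a (c + 1) := by
  rw [← seg_self_succ, seg_mul_seg h (Nat.le_succ c)]

theorem Commute.seg_right {a c : ℕ} {z : TL n} (h : ∀ i, a ≤ i → i < c → Commute z (e n i)) :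
    Commute z (seg n a c) := by
  refine Commute.list_prod_right _ _ fun y hy => ?_
  obtain ⟨i, hi, rfl⟩ := List.mem_map.1 hy
  rw [List.mem_range'_1] at hi
  exact h i hi.1 (by omega)

theorem commute_e_seg {i a c : ℕ} (h : i + 2 ≤ a ∨ c + 1 ≤ i) : Commute (e n i) (seg n a c) :=
  Commute.seg_right fun j h1 h2 => commute_e (by omega)

theorem commute_seg_seg {a b c d : ℕ} (h : b + 1 ≤ c) : Commute (seg n a b) (seg n c d) :=
  Commute.seg_right fun j h1 h2 => (commute_e_seg (by omega)).symm

theorem seg_mul_e_pred {a c : ℕ} (h : a ≤ c) :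
    seg n a (c + 1) * e n c = (X : ℤ[X]) • seg n a (c + 1) := by
  rw [← seg_mul_e h, mul_assoc, e_mul_self, mul_smul_comm]

theorem seg_mul_e_pred_pred {a c : ℕ} (ha : 1 ≤ a) (h : a ≤ c) (hc : c + 2 ≤ n) :
    seg n a (c + 2) * e n c = seg n a (c + 1) := by
  rw [← seg_mul_e (by omega), ← seg_mul_e h, mul_assoc, mul_assoc, ← mul_assoc (e n c),
    e_mul_e_mul_e ⟨by omega, by omega⟩ ⟨by omega, by omega⟩ (by omega)]

/-- Both sides equal `seg n a (i + 1) * seg n (i + 2) c`: on the left `e_i e_{i+1} e_i` collapses,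
on the right `e_{i+2} e_{i+1} e_{i+2}` does. -/
theorem seg_mul_e_of_lt {a c i : ℕ} (ha : 1 ≤ a) (h : a ≤ i) (hi : i + 3 ≤ c) (hc : c ≤ n) :
    seg n a c * e n i = e n (i + 2) * seg n a c := by
  have h1 : seg n a c = seg n a (i + 1) * e n (i + 1) * seg n (i + 2) c := by
    rw [seg_mul_e (by omega), seg_mul_seg (by omega) (by omega)]
  have h2 : seg n (i + 2) c = e n (i + 2) * seg n (i + 3) c := (e_mul_seg (by omega)).symm
  have h3 : seg n a c * e n i = seg n a (i + 1) * seg n (i + 2) c := by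
    rw [h1, mul_assoc, ← (commute_e_seg (i := i) (a := i + 2) (c := c) (by omega)).eq, ← mul_assoc,
      seg_mul_e (by omega), seg_mul_e_pred_pred ha h (by omega)]
  rw [h3, h1, mul_assoc, ← mul_assoc (e n (i + 2)),
    (commute_e_seg (n := n) (i := i + 2) (a := a) (c := i + 1) (by omega)).eq, mul_assoc, h2,
    ← mul_assoc (e n (i + 1)), ← mul_assoc (e n (i + 2)), ← mul_assoc (e n (i + 2)),
    e_mul_e_mul_e ⟨by omega, by omega⟩ ⟨by omega, by omega⟩ (by omega)]

/-- The exchange relation between two products of consecutive generators. -/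
theorem seg_mul_seg_exchange {a b c : ℕ} (ha : 1 ≤ a) (hab : a + 1 ≤ b) (hbc : b + 2 ≤ c)
    (hc : c ≤ n) : seg n (a + 2) (b + 2) * seg n a c = seg n (a + 2) c * seg n a b := by
  have h1 : seg n (a + 2) (b + 2) = seg n (a + 2) (b + 1) * e n (b + 1) :=
    (seg_mul_e (by omega)).symm
  have h2 : seg n a (b + 2) = seg n a b * (e n b * e n (b + 1)) := by
    rw [← mul_assoc, seg_mul_e (by omega), seg_mul_e (by omega)]
  -- The case `c = b + 2`, where `e_{b+1} e_b e_{b+1}` collapses; the general case follows by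
  -- multiplying with `[b + 2, c]`, which commutes with `[a, b]`.
  have h3 : seg n (a + 2) (b + 2) * seg n a (b + 2) = seg n (a + 2) (b + 2) * seg n a b := by
    rw [h1, h2, mul_assoc, ← mul_assoc (e n (b + 1)),
      (commute_e_seg (n := n) (i := b + 1) (a := a) (c := b) (by omega)).eq, mul_assoc,
      ← mul_assoc (e n (b + 1)), e_mul_e_mul_e ⟨by omega, by omega⟩ ⟨by omega, by omega⟩ (by omega),
      mul_assoc, (commute_e_seg (n := n) (i := b + 1) (a := a) (c := b) (by omega)).eq]
  rw [← seg_mul_seg (n := n) (a := a) (b := b + 2) (c := c) (by omega) hbc, ← mul_assoc, h3,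
    mul_assoc, (commute_seg_seg (n := n) (a := a) (b := b) (c := b + 2) (d := c) (by omega)).eq,
    ← mul_assoc, seg_mul_seg (by omega) hbc]

/-- The product `e_{c-1} ⋯ e_{a+1} e_a e_{a+1} ⋯ e_{c-1}` collapses from the middle. Read backwards,
this lets a stray generator be absorbed as a new closing position of both lists. -/
theorem tlStar_seg_mul_seg {a c : ℕ} (ha : 1 ≤ a) (hac : a < c) (hc : c ≤ n) :
    tlStar n (seg n (a + 1) c) * seg n a c = e n (c - 1) := by
  obtain ⟨d, rfl⟩ : ∃ d, c = a + d + 1 := ⟨c - a - 1, by omega⟩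
  induction d with
  | zero => simp [seg_of_le, tlStar_one, seg_self_succ]
  | succ d ih =>
    have h1 := ih (by omega) (by omega)
    rw [← add_assoc, ← seg_mul_e (by omega), tlStar_mul, tlStar_e, mul_assoc,
      ← seg_mul_e (a := a) (by omega), ← mul_assoc (tlStar n _), h1]
    simp only [Nat.add_sub_cancel]
    rw [← mul_assoc, e_mul_e_mul_e ⟨by omega, by omega⟩ ⟨by omega, by omega⟩ (by omega)]

theorem w_eq_seg {i j : ℕ} (h : i ≤ j) : w n i j = seg n i j := by
  rcases h.lt_or_eq with h | rfl
  · rw [w, if_pos h, seg]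
  · simp [w, seg]

theorem tlStar_list_prod (l : List ℕ) :
    tlStar n (l.map (e n)).prod = (l.reverse.map (e n)).prod := by
  induction l with
  | nil => simp [tlStar_one]
  | cons a l ih => simp [tlStar_mul, tlStar_e, ih]

theorem w_eq_tlStar_seg {i j : ℕ} (h : i ≤ j) : w n j i = tlStar n (seg n i j) := by
  rcases h.lt_or_eq with h | rfl
  · rw [w, if_neg (by omega), if_pos h, seg, tlStar_list_prod]
  · simp [w, seg, tlStar_one]

/-! ### Words attached to lists of closing positions -/

/-- `Valid n o L` says that the `j`-th entry (`j = 1, 2, …`) of `L` lies in `[o + 2j, n]`. -/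
def Valid (n : ℕ) : ℕ → List ℕ → Prop
  | _, [] => True
  | o, k :: L => o + 2 ≤ k ∧ k ≤ n ∧ Valid n (o + 2) L

/-- `⋯ [o + 3, k₂] [o + 1, k₁]`, where `[a, k]` stands for `e_a ⋯ e_{k-1}`. -/
noncomputable def pWord (n : ℕ) : ℕ → List ℕ → TL n
  | _, [] => 1
  | o, k :: L => pWord n (o + 2) L * seg n (o + 1) k

/-- `⋯ [o + 4, k₂] [o + 2, k₁]`, where `[a, k]` stands for `e_a ⋯ e_{k-1}`. -/
noncomputable def vWord (n : ℕ) : ℕ → List ℕ → TL n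
  | _, [] => 1
  | o, k :: L => vWord n (o + 2) L * seg n (o + 2) k

/-- `e_1 e_3 ⋯ e_{2g-1}`. -/
noncomputable def mWord (n g : ℕ) : TL n := ((List.range g).map fun i => e n (2 * i + 1)).prod

theorem valid_append {o k : ℕ} {L : List ℕ} :
    Valid n o (L ++ [k]) ↔ Valid n o L ∧ o + 2 * L.length + 2 ≤ k ∧ k ≤ n := by
  induction L generalizing o with
  | nil => simp [Valid]
  | cons a L ih =>
    simp only [List.cons_append, Valid, ih, List.length_cons]
    constructor
    · rintro ⟨h1, h2, h3, h4, h5⟩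
      exact ⟨⟨h1, h2, h3⟩, by omega, h5⟩
    · rintro ⟨⟨h1, h2, h3⟩, h4, h5⟩
      exact ⟨h1, h2, h3, by omega, h5⟩

theorem Valid.le {o : ℕ} {L : List ℕ} (h : Valid n o L) : ∀ x ∈ L, o + 2 ≤ x ∧ x ≤ n := by
  induction L generalizing o with
  | nil => simp
  | cons a L ih =>
    intro x hx
    rcases List.mem_cons.1 hx with rfl | hx
    · exact ⟨h.1, h.2.1⟩
    · have := ih h.2.2 x hx
      omega

theorem pWord_append (o k : ℕ) (L : List ℕ) :
    pWord n o (L ++ [k]) = seg n (o + 2 * L.length + 1) k * pWord n o L := by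
  induction L generalizing o with
  | nil => simp [pWord]
  | cons a L ih =>
    rw [List.cons_append, pWord, ih, pWord, mul_assoc, List.length_cons,
      show o + 2 + 2 * L.length + 1 = o + 2 * (L.length + 1) + 1 by ring]

theorem vWord_append (o k : ℕ) (L : List ℕ) :
    vWord n o (L ++ [k]) = seg n (o + 2 * L.length + 2) k * vWord n o L := by
  induction L generalizing o with
  | nil => simp [vWord]
  | cons a L ih =>
    rw [List.cons_append, vWord, ih, vWord, mul_assoc, List.length_cons,
      show o + 2 + 2 * L.length + 2 = o + 2 * (L.length + 1) + 2 by ring]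

theorem mWord_succ (g : ℕ) : mWord n (g + 1) = mWord n g * e n (2 * g + 1) := by
  simp [mWord, List.range_succ]

theorem Commute.mWord_right {g : ℕ} {z : TL n} (h : ∀ i, i < g → Commute z (e n (2 * i + 1))) :
    Commute z (mWord n g) := by
  refine Commute.list_prod_right _ _ fun y hy => ?_
  obtain ⟨i, hi, rfl⟩ := List.mem_map.1 hy
  exact h i (List.mem_range.1 hi)

theorem tlStar_mWord (g : ℕ) : tlStar n (mWord n g) = mWord n g := by
  induction g with
  | zero => simp [mWord, tlStar_one]
  | succ g ih =>
    rw [mWord_succ, tlStar_mul, ih, tlStar_e]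
    exact (Commute.mWord_right fun i hi => commute_e (by omega)).eq

/-- Each generator `e_{2g+1}` of `m` moves right until it completes `[2g+2, k]` to `[2g+1, k]`. -/
theorem pWord_eq {L : List ℕ} (h : Valid n 0 L) :
    pWord n 0 L = mWord n L.length * vWord n 0 L := by
  induction L using List.reverseRecOn with
  | nil => simp [pWord, vWord, mWord]
  | append_singleton L k ih =>
    rw [valid_append] at h
    rw [pWord_append, vWord_append, ih h.1, List.length_append, List.length_singleton, mWord_succ,
      ← mul_assoc, mul_assoc (mWord n _), ← mul_assoc (e n _)]
    simp only [zero_add] at h ⊢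
    rw [e_mul_seg (by omega), ← mul_assoc]
    congr 1
    refine (Commute.mWord_right fun i hi => ?_).eq
    exact (commute_e_seg (by omega)).symm

/-- The element `v_A^* m v_B` attached to two lists of closing positions. -/
noncomputable def qWord (n : ℕ) (A B : List ℕ) : TL n := tlStar n (vWord n 0 A) * pWord n 0 B

theorem tlStar_qWord {A B : List ℕ} (hA : Valid n 0 A) (hB : Valid n 0 B)
    (h : A.length = B.length) : tlStar n (qWord n A B) = qWord n B A := by
  rw [qWord, qWord, tlStar_mul, tlStar_tlStar, pWord_eq hA, pWord_eq hB, tlStar_mul, tlStar_mWord,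
    h, mul_assoc]

theorem qWord_congr_right (A : List ℕ) {B B' : List ℕ} (h : pWord n 0 B = pWord n 0 B') :
    qWord n A B = qWord n A B' := by rw [qWord, qWord, h]

/-- Sorting controls only `pWord`, while the left list enters through `vWord`; the anti-involution
moves that list to the right, where `pWord` appears. -/
theorem qWord_congr_left {A A' B : List ℕ} (hA : Valid n 0 A) (hA' : Valid n 0 A')
    (hB : Valid n 0 B) (hl : A.length = B.length) (hl' : A'.length = B.length)
    (h : pWord n 0 A = pWord n 0 A') : qWord n A B = qWord n A' B := by
  rw [← tlStar_qWord hB hA hl.symm, ← tlStar_qWord hB hA' hl'.symm, qWord_congr_right B h]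

/-! ### Sorting -/

/-- One insertion of an insertion sort. Each entry of `L` that `b` overtakes drops by `2`, since it
moves one slot forward; this is why the lower bound `d` asks for `d + 2 < x` on `L`. -/
theorem exists_insert {L : List ℕ} {o b : ℕ} (hb : o + 2 ≤ b) (hbn : b ≤ n)
    (hL : Valid n (o + 2) L) (hs : L.Pairwise (· < ·)) :
    ∃ L' : List ℕ, L'.length = L.length + 1 ∧ Valid n o L' ∧ L'.Pairwise (· < ·) ∧
      (∀ d, d < b → (∀ x ∈ L, d + 2 < x) → ∀ x ∈ L', d < x) ∧
      pWord n o L' = pWord n o (b :: L) := by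
  induction L generalizing o with
  | nil => exact ⟨[b], by simp [Valid, hb, hbn]⟩
  | cons c L ih =>
    rw [List.pairwise_cons] at hs
    by_cases hbc : b < c
    · refine ⟨b :: c :: L, by simp, ⟨hb, hbn, hL⟩, ?_, ?_, rfl⟩
      · refine List.pairwise_cons.2 ⟨fun x hx => ?_, List.pairwise_cons.2 hs⟩
        rcases List.mem_cons.1 hx with rfl | hx
        · exact hbc
        · exact hbc.trans (hs.1 x hx)
      · intro d hd h x hx
        rcases List.mem_cons.1 hx with rfl | hx
        · exact hd
        · have := h x hx
          omega
    · obtain ⟨hc, hcn, hL⟩ := hL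
      obtain ⟨c, rfl⟩ : ∃ c', c = c' + 2 := ⟨c - 2, by omega⟩
      obtain ⟨L', h1, h2, h3, h4, h5⟩ := ih (o := o + 2) (by omega) hL hs.2
      refine ⟨c :: L', by simp [h1], ⟨by omega, by omega, h2⟩, ?_, ?_, ?_⟩
      · exact List.pairwise_cons.2 ⟨h4 c (by omega) hs.1, h3⟩
      · intro d hd h x hx
        rcases List.mem_cons.1 hx with rfl | hx
        · have := h (x + 2) (by simp)
          omega
        · exact h4 d hd (fun y hy => h y (by simp [hy])) x hx
      · simp only [pWord] at h5 ⊢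
        rw [h5, mul_assoc, mul_assoc, show o + 2 + 1 = o + 1 + 2 by ring,
          seg_mul_seg_exchange (by omega) (by omega) (by omega) hbn]

/-- `Starts o f L` says that `L` starts with `o + 2, o + 4, …, o + 2f`. -/
def Starts : ℕ → ℕ → List ℕ → Prop
  | _, 0, _ => True
  | _, _ + 1, [] => False
  | o, f + 1, k :: L => k = o + 2 ∧ Starts (o + 2) f L

theorem Starts.append {o f k : ℕ} {L : List ℕ} (h : Starts o f L) : Starts o f (L ++ [k]) := by
  induction L generalizing o f with
  | nil => cases f <;> simp_all [Starts]
  | cons a L ih =>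
    cases f with
    | zero => trivial
    | succ f => exact ⟨h.1, ih h.2⟩

/-- Sorting a list of closing positions does not change its word. -/
theorem exists_sorted {L : List ℕ} {o f : ℕ} (hL : Valid n o L) (hf : Starts o f L) :
    ∃ L' : List ℕ, L'.length = L.length ∧ Valid n o L' ∧ L'.Pairwise (· < ·) ∧
      Starts o f L' ∧ pWord n o L' = pWord n o L := by
  induction L generalizing o f with
  | nil => exact ⟨[], rfl, trivial, List.Pairwise.nil, hf, rfl⟩
  | cons k L ih =>
    obtain ⟨h1, h2, h3⟩ := hL
    cases f with
    | zero =>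
      obtain ⟨L', hl, hv, hs, -, hp⟩ := ih (f := 0) h3 trivial
      obtain ⟨L'', hl', hv', hs', -, hp'⟩ := exists_insert h1 h2 hv hs
      exact ⟨L'', by simp [hl', hl], hv', hs', trivial, by rw [hp', pWord, hp, pWord]⟩
    | succ f =>
      obtain ⟨rfl, hf⟩ := hf
      obtain ⟨L', hl, hv, hs, hf', hp⟩ := ih h3 hf
      refine ⟨(o + 2) :: L', by simp [hl], ⟨h1, h2, hv⟩, ?_, ⟨rfl, hf'⟩, by rw [pWord, hp, pWord]⟩
      -- Validity at offset `o + 2` makes every later entry at least `o + 4`, so the prefix is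
      -- already in place.
      exact List.pairwise_cons.2 ⟨fun x hx => by have := hv.le x hx; omega, hs⟩

/-! ### Right multiplication by a generator -/

/-- The generator first meets the segment `[o + 1, k]` of the head `k`. It commutes past if `k < i`,
lengthens the segment if `k = i`, gives the factor `x` if `k = i + 1`, shortens it if `k = i + 2`,
and emerges on its left as `e_{i+2}` if `k ≥ i + 3`. When it passes, its index is at least `o + 3`,
so the argument repeats with the tail. -/
theorem pWord_mul_e {L : List ℕ} {o i : ℕ} (hL : Valid n o L) (hi : o + 1 ≤ i) (hin : i < n) :
    (∃ (L' : List ℕ) (c : ℤ[X]), L'.length = L.length ∧ Valid n o L' ∧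
      pWord n o L * e n i = c • pWord n o L') ∨
    ∃ j, o + 2 * L.length + 1 ≤ j ∧ j < n ∧ pWord n o L * e n i = e n j * pWord n o L := by
  induction L generalizing o i with
  | nil => exact Or.inr ⟨i, by simpa using hi, hin, by simp [pWord]⟩
  | cons k L ih =>
    obtain ⟨h1, h2, h3⟩ := hL
    have key : ∀ j, o + 3 ≤ j → j < n → seg n (o + 1) k * e n i = e n j * seg n (o + 1) k →
        (∃ (L' : List ℕ) (c : ℤ[X]), L'.length = (k :: L).length ∧ Valid n o L' ∧
          pWord n o (k :: L) * e n i = c • pWord n o L') ∨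
        ∃ j, o + 2 * (k :: L).length + 1 ≤ j ∧ j < n ∧
          pWord n o (k :: L) * e n i = e n j * pWord n o (k :: L) := by
      intro j hj hjn h
      rcases ih (o := o + 2) (i := j) h3 hj hjn with ⟨L', c, hl, hv, hp⟩ | ⟨l, hl, hln, hp⟩
      · refine Or.inl ⟨k :: L', c, by simp [hl], ⟨h1, h2, hv⟩, ?_⟩
        rw [pWord, mul_assoc, h, ← mul_assoc, hp, pWord, smul_mul_assoc]
      · refine Or.inr ⟨l, by simp only [List.length_cons]; omega, hln, ?_⟩
        rw [pWord, mul_assoc, h, ← mul_assoc, hp, mul_assoc]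
    have key' : ∀ (k' : ℕ) (c : ℤ[X]), o + 2 ≤ k' → k' ≤ n →
        seg n (o + 1) k * e n i = c • seg n (o + 1) k' →
        (∃ (L' : List ℕ) (c : ℤ[X]), L'.length = (k :: L).length ∧ Valid n o L' ∧
          pWord n o (k :: L) * e n i = c • pWord n o L') := by
      intro k' c hk hkn h
      exact ⟨k' :: L, c, by simp, ⟨hk, hkn, h3⟩, by rw [pWord, mul_assoc, h, pWord, mul_smul_comm]⟩
    rcases lt_or_ge k i with hki | hki
    · exact key i (by omega) hin (commute_e_seg (by omega)).eq.symm
    rcases hki.lt_or_eq with hki | rfl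
    · obtain ⟨k, rfl⟩ : ∃ k', k = k' + 1 := ⟨k - 1, by omega⟩
      rcases (Nat.le_of_lt_succ hki).lt_or_eq with hki' | rfl
      · obtain ⟨k, rfl⟩ : ∃ k', k = k' + 1 := ⟨k - 1, by omega⟩
        rcases (Nat.le_of_lt_succ hki').lt_or_eq with hki' | rfl
        · exact key (i + 2) (by omega) (by omega) (seg_mul_e_of_lt (by omega) hi (by omega) h2)
        · exact Or.inl (key' (i + 1) 1 (by omega) (by omega)
            (by rw [one_smul, seg_mul_e_pred_pred (by omega) hi h2]))
      · exact Or.inl (key' (i + 1) X h1 h2 (seg_mul_e_pred hi))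
    · exact Or.inl (key' (i + 1) 1 (by omega) (by omega) (by rw [one_smul, seg_mul_e hi]))

theorem qWord_mul_e {A B : List ℕ} {i : ℕ} (hB : Valid n 0 B)
    (h : A.length = B.length) (hi : 1 ≤ i) (hin : i < n) :
    (∃ (B' : List ℕ) (c : ℤ[X]), B'.length = B.length ∧ Valid n 0 B' ∧
      qWord n A B * e n i = c • qWord n A B') ∨
    ∃ k, 2 * B.length + 2 ≤ k ∧ k ≤ n ∧
      qWord n A B * e n i = qWord n (A ++ [k]) (B ++ [k]) := by
  rcases pWord_mul_e hB (by omega) hin with ⟨B', c, hl, hv, hp⟩ | ⟨j, hj, hjn, hp⟩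
  · exact Or.inl ⟨B', c, hl, hv, by rw [qWord, mul_assoc, hp, qWord, mul_smul_comm]⟩
  · refine Or.inr ⟨j + 1, by omega, by omega, ?_⟩
    rw [qWord, mul_assoc, hp, qWord, vWord_append, pWord_append, tlStar_mul, mul_assoc,
      ← mul_assoc (tlStar n (seg n _ _)), h, tlStar_seg_mul_seg (by omega) (by omega) (by omega),
      Nat.add_sub_cancel]

/-- The entries `o + 2, o + 4, …` of the prefix contribute empty segments; only later ones
contribute generators. -/
theorem vWord_mem_adjoin {L : List ℕ} {o f : ℕ} (hL : Valid n o L) (hf : Starts o f L) :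
    vWord n o L ∈ Algebra.adjoin ℤ[X]
      {a : TL n | ∃ i : ℕ, o + 2 * f + 1 ≤ i ∧ i < n ∧ a = e n i} := by
  induction L generalizing o f with
  | nil => exact one_mem _
  | cons k L ih =>
    obtain ⟨h1, h2, h3⟩ := hL
    cases f with
    | zero =>
      refine mul_mem ?_ ?_
      · refine Algebra.adjoin_mono ?_ (ih (f := 0) h3 trivial)
        rintro a ⟨i, hi, h⟩
        exact ⟨i, by omega, h⟩
      · refine Subalgebra.list_prod_mem _ fun y hy => ?_
        obtain ⟨i, hi, rfl⟩ := List.mem_map.1 hy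
        rw [List.mem_range'_1] at hi
        exact Algebra.subset_adjoin ⟨i, by omega, by omega, rfl⟩
    | succ f =>
      obtain ⟨rfl, hf⟩ := hf
      rw [vWord, seg_of_le le_rfl, mul_one, show o + 2 * (f + 1) + 1 = o + 2 + 2 * f + 1 by ring]
      exact ih h3 hf

theorem vWord_eq_one {L : List ℕ} {o : ℕ} (hf : Starts o L.length L) : vWord n o L = 1 := by
  induction L generalizing o with
  | nil => rfl
  | cons k L ih => rw [vWord, ih hf.2, hf.1, seg_of_le le_rfl, mul_one]

/-! ### Tableaux and their closing positions -/

/-- The list of the positions `j ≤ k` at which the first component of the shape increases. -/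
def closersRes {lam : Partn n} (t : Tab n lam) : (k : ℕ) → k ≤ n → List ℕ
  | 0, _ => []
  | k + 1, h =>
    if (t.seq k (Nat.le_of_succ_le h)).1.1 = (t.seq (k + 1) h).1.1 then
      closersRes t k (Nat.le_of_succ_le h)
    else closersRes t k (Nat.le_of_succ_le h) ++ [k + 1]

/-- The list of all closing positions of a tableau. -/
def closers {lam : Partn n} (t : Tab n lam) : List ℕ := closersRes t n le_rfl

section

variable {lam : Partn n} (t : Tab n lam)

theorem Tab.succ_of_ne {k : ℕ} (h : k + 1 ≤ n)
    (hne : (t.seq k (Nat.le_of_succ_le h)).1.1 ≠ (t.seq (k + 1) h).1.1) :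
    (t.seq (k + 1) h).1.1 = (t.seq k (Nat.le_of_succ_le h)).1.1 + 1 := by
  rcases t.step k h with h' | h'
  · exact absurd h'.1 hne
  · exact h'.1.symm

theorem length_closersRes (k : ℕ) (h : k ≤ n) :
    (closersRes t k h).length = (t.seq k h).1.1 := by
  induction k with
  | zero => rw [closersRes, t.start]; rfl
  | succ k ih =>
    rw [closersRes]
    split_ifs with hc
    · rw [ih, hc]
    · rw [List.length_append, ih, List.length_singleton, t.succ_of_ne h hc]

theorem valid_closersRes (k : ℕ) (h : k ≤ n) : Valid n 0 (closersRes t k h) := by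
  induction k with
  | zero => trivial
  | succ k ih =>
    rw [closersRes]
    split_ifs with hc
    · exact ih _
    · have h1 := t.succ_of_ne h hc
      have h2 := (t.seq (k + 1) h).2
      exact valid_append.2 ⟨ih _, by rw [length_closersRes]; omega, h⟩

theorem le_of_mem_closersRes (k : ℕ) (h : k ≤ n) : ∀ x ∈ closersRes t k h, x ≤ k := by
  induction k with
  | zero => simp [closersRes]
  | succ k ih =>
    rw [closersRes]
    intro x hx
    split_ifs at hx with hc
    · exact (ih _ x hx).trans k.le_succ
    · rcases List.mem_append.1 hx with hx | hx
      · exact (ih _ x hx).trans k.le_succ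
      · exact (List.mem_singleton.1 hx).le

theorem pairwise_closersRes (k : ℕ) (h : k ≤ n) : (closersRes t k h).Pairwise (· < ·) := by
  induction k with
  | zero => exact List.Pairwise.nil
  | succ k ih =>
    rw [closersRes]
    split_ifs with hc
    · exact ih _
    · refine List.pairwise_append.2 ⟨ih _, List.pairwise_singleton _ _, fun x hx y hy => ?_⟩
      rw [List.mem_singleton.1 hy]
      exact Nat.lt_succ_of_le (le_of_mem_closersRes t k _ x hx)

theorem filter_closersRes {k l : ℕ} (hkl : k ≤ l) (h : l ≤ n) :
    (closersRes t l h).filter (· ≤ k) = closersRes t k (hkl.trans h) := by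
  induction l, hkl using Nat.le_induction with
  | base =>
    rw [List.filter_eq_self]
    simpa using le_of_mem_closersRes t k h
  | succ l hl ih =>
    rw [closersRes]
    split_ifs with hc
    · exact ih _
    · rw [List.filter_append, ih]
      simp [Nat.lt_succ_of_le hl]

theorem vRes_eq (k : ℕ) (h : k ≤ n) : vRes t k h = vWord n 0 (closersRes t k h) := by
  induction k with
  | zero => rfl
  | succ k ih =>
    rw [closersRes, vRes]
    split_ifs with hc
    · exact ih _
    · have h1 := t.succ_of_ne h hc
      have h2 := (t.seq (k + 1) h).2
      rw [vWord_append, length_closersRes, ih, w_eq_seg (by omega), h1]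
      congr 2
      ring

theorem vStarRes_eq (k : ℕ) (h : k ≤ n) :
    vStarRes t k h = tlStar n (vWord n 0 (closersRes t k h)) := by
  induction k with
  | zero => exact tlStar_one.symm
  | succ k ih =>
    rw [closersRes, vStarRes]
    split_ifs with hc
    · exact ih _
    · have h1 := t.succ_of_ne h hc
      have h2 := (t.seq (k + 1) h).2
      rw [vWord_append, length_closersRes, ih, w_eq_tlStar_seg (by omega), h1, tlStar_mul]
      congr 3
      ring

theorem length_closers : (closers t).length = lam.1.1 := by
  rw [closers, length_closersRes, t.last]

theorem valid_closers : Valid n 0 (closers t) := valid_closersRes t n le_rfl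

theorem pairwise_closers : (closers t).Pairwise (· < ·) := pairwise_closersRes t n le_rfl

theorem v_eq : v t = vWord n 0 (closers t) := vRes_eq t n le_rfl

theorem vStar_eq : vStar t = tlStar n (vWord n 0 (closers t)) := vStarRes_eq t n le_rfl

theorem mShape_mul_v : mShape lam * v t = pWord n 0 (closers t) := by
  rw [v_eq, pWord_eq (valid_closers t), length_closers]
  rfl

theorem m_eq_qWord (s t : Tab n lam) : m s t = qWord n (closers s) (closers t) := by
  rw [m, mul_assoc, mShape_mul_v, vStar_eq, qWord]

theorem tlStar_m (s t : Tab n lam) : tlStar n (m s t) = m t s := by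
  rw [m_eq_qWord, m_eq_qWord, tlStar_qWord (valid_closers s) (valid_closers t)]
  rw [length_closers, length_closers]

end

theorem Partn.ext_fst {lam mu : Partn n} (h : lam.1.1 = mu.1.1) : lam = mu := by
  have h1 := lam.2
  have h2 := mu.2
  exact Subtype.ext (Prod.ext h (by omega))

theorem sDom_iff {lam mu : Partn n} : SDom lam mu ↔ mu.1.1 < lam.1.1 := by
  constructor
  · rintro ⟨h, hne⟩
    exact lt_of_le_of_ne h fun h' => hne (Partn.ext_fst h'.symm)
  · intro h
    exact ⟨h.le, fun h' => by simp [h'] at h⟩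

/-- The first component of the `k`-th shape is the number of closing positions that are at most `k`.
-/
theorem closers_injective {lam : Partn n} : Function.Injective (closers (lam := lam)) := by
  intro s t h
  ext1
  funext k hk
  apply Partn.ext_fst
  rw [← length_closersRes, ← length_closersRes, ← filter_closersRes s hk le_rfl,
    ← filter_closersRes t hk le_rfl]
  exact congrArg (fun l => (l.filter (· ≤ k)).length) h

theorem two_mul_length_filter_le {L : List ℕ} (hL : Valid n 0 L) (k : ℕ) :
    2 * (L.filter (· ≤ k)).length ≤ k := by
  induction L using List.reverseRecOn with
  | nil => simp
  | append_singleton L c ih =>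
    rw [valid_append] at hL
    have h1 := ih hL.1
    have h2 := List.length_filter_le (fun x => decide (x ≤ k)) L
    rw [List.filter_append, List.length_append]
    -- If the last entry is at most `k`, validity bounds twice the length of the whole list by it;
    -- otherwise it is filtered out.
    by_cases hc : c ≤ k
    · simp [hc]
      omega
    · simpa [hc] using h1

theorem filter_le_succ {L : List ℕ} (hL : L.Pairwise (· < ·)) (k : ℕ) :
    L.filter (· ≤ k + 1) = L.filter (· ≤ k) ++ if k + 1 ∈ L then [k + 1] else [] := by
  induction L with
  | nil => simp
  | cons a L ih =>
    rw [List.pairwise_cons] at hL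
    have ih := ih hL.2
    rcases lt_trichotomy a (k + 1) with h | h | h
    · rw [List.filter_cons_of_pos (by simpa using h.le),
        List.filter_cons_of_pos (by simpa using Nat.le_of_lt_succ h), ih]
      simp [h.ne']
    · subst h
      have h1 : L.filter (· ≤ k + 1) = [] := by
        rw [List.filter_eq_nil_iff]
        intro x hx
        simpa using hL.1 x hx
      have h2 : L.filter (· ≤ k) = [] := by
        rw [List.filter_eq_nil_iff]
        intro x hx
        have := hL.1 x hx
        simp
        omega
      simp [h1, h2]
    · have h1 : k + 1 ∉ L := fun hx => by
        have := hL.1 _ hx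
        omega
      rw [List.filter_cons_of_neg (by simpa using h), ih,
        List.filter_cons_of_neg (by simp; omega)]
      simp [h.ne, h1]

/-- The `k`-th shape is defined by counting the entries at most `k`; the inequality
`two_mul_length_filter_le` makes it a partition of `k`. -/
theorem exists_closers_eq {L : List ℕ} (hL : Valid n 0 L) (hs : L.Pairwise (· < ·))
    {lam : Partn n} (hlam : lam.1.1 = L.length) : ∃ t : Tab n lam, closers t = L := by
  let sq : (k : ℕ) → k ≤ n → Partn k := fun k _ =>
    ⟨((L.filter (· ≤ k)).length, k - 2 * (L.filter (· ≤ k)).length), by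
      have := two_mul_length_filter_le hL k
      simp only
      omega⟩
  have hfull : L.filter (· ≤ n) = L := by
    rw [List.filter_eq_self]
    simpa using fun x hx => (hL.le x hx).2
  have hstep : ∀ k, (L.filter (· ≤ k + 1)).length =
      (L.filter (· ≤ k)).length + if k + 1 ∈ L then 1 else 0 := by
    intro k
    rw [filter_le_succ hs, List.length_append]
    split_ifs <;> rfl
  let t : Tab n lam :=
    { seq := sq
      start := Partn.ext_fst (by
        have := two_mul_length_filter_le hL 0
        simp only [sq]
        omega)
      step := by
        intro k hk
        have h1 := hstep k
        have h2 := two_mul_length_filter_le hL k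
        have h3 := two_mul_length_filter_le hL (k + 1)
        simp only [Arrow, sq]
        split_ifs at h1 <;> omega
      last := Partn.ext_fst (by simp only [sq]; rw [hfull, hlam]) }
  refine ⟨t, ?_⟩
  have key : ∀ k h, closersRes t k h = L.filter (· ≤ k) := by
    intro k h
    induction k with
    | zero =>
      have := two_mul_length_filter_le hL 0
      exact (List.length_eq_zero_iff.1 (by omega)).symm
    | succ k ih =>
      rw [closersRes, ih, filter_le_succ hs]
      have h1 := hstep k
      change (if (L.filter (· ≤ k)).length = (L.filter (· ≤ k + 1)).length then _ else _) = _
      by_cases hk : k + 1 ∈ L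
      · rw [if_pos hk] at h1 ⊢
        rw [if_neg (by omega)]
      · rw [if_neg hk] at h1 ⊢
        rw [if_pos (by omega), List.append_nil]
  rw [closers, key, hfull]

/-! ### Right ideals spanned by basis elements -/

/-- The pairs of tableaux of a shape with first component at least `g`, the first tableau
of which starts with the closing positions `2, 4, …, 2f`. -/
def pairsAbove (n f g : ℕ) : Set (Pairs n) :=
  {p | g ≤ p.1.1.1 ∧ Starts 0 f (closers p.2.1)}

theorem two_mul_length_le {L : List ℕ} (hL : Valid n 0 L) : 2 * L.length ≤ n := by
  have h := two_mul_length_filter_le hL n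
  rwa [List.filter_eq_self.2 (by simpa using fun x hx => (hL.le x hx).2)] at h

theorem qWord_mem_span {A B : List ℕ} {f g : ℕ} (hA : Valid n 0 A) (hB : Valid n 0 B)
    (h : A.length = B.length) (hf : Starts 0 f A) (hg : g ≤ B.length) :
    qWord n A B ∈ Submodule.span ℤ[X] (mFam n '' pairsAbove n f g) := by
  obtain ⟨A', hlA, hvA, hsA, hfA, hpA⟩ := exists_sorted hA hf
  obtain ⟨B', hlB, hvB, hsB, -, hpB⟩ := exists_sorted (f := 0) hB trivial
  have hn := two_mul_length_le hB
  let lam : Partn n := ⟨(B.length, n - 2 * B.length), by simp only; omega⟩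
  obtain ⟨s, hs⟩ := exists_closers_eq (lam := lam) hvA hsA (by simp only [lam]; omega)
  obtain ⟨t, ht⟩ := exists_closers_eq (lam := lam) hvB hsB (by simp only [lam]; omega)
  refine Submodule.subset_span ⟨⟨lam, s, t⟩, ⟨hg, by simpa only [hs] using hfA⟩, ?_⟩
  rw [mFam, m_eq_qWord]
  simp only [hs, ht]
  rw [qWord_congr_right A' hpB, qWord_congr_left hvA hA hB (by omega) h hpA]

/-- Right multiplication keeps the left list or appends to it, so the prefix condition is preserved
and the length never decreases. -/
theorem mul_mem_span_pairsAbove {f g : ℕ} (b : TL n) :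
    ∀ a ∈ Submodule.span ℤ[X] (mFam n '' pairsAbove n f g),
      a * b ∈ Submodule.span ℤ[X] (mFam n '' pairsAbove n f g) := by
  refine mul_mem_of_mul_e_mem (fun i hi hin a ha => ?_) b
  induction ha using Submodule.span_induction with
  | zero => rw [zero_mul]; exact zero_mem _
  | add a b _ _ ha hb => rw [add_mul]; exact add_mem ha hb
  | smul r a _ ha => rw [smul_mul_assoc]; exact Submodule.smul_mem _ _ ha
  | mem a ha =>
    obtain ⟨⟨lam, s, t⟩, ⟨hg, hf⟩, rfl⟩ := ha
    have hl : (closers s).length = (closers t).length := by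
      rw [length_closers, length_closers]
    have hvs := valid_closers s
    have hvt := valid_closers t
    have hg' : g ≤ (closers t).length := by rwa [length_closers]
    rw [mFam, m_eq_qWord]
    rcases qWord_mul_e hvt hl hi hin with ⟨B, c, hlB, hvB, h⟩ | ⟨k, hk, hkn, h⟩
    · rw [h]
      exact Submodule.smul_mem _ _ (qWord_mem_span hvs hvB (by omega) hf (by omega))
    · rw [h]
      refine qWord_mem_span (valid_append.2 ⟨hvs, by omega, hkn⟩)
        (valid_append.2 ⟨hvt, by omega, hkn⟩) (by simp [hl]) hf.append ?_
      rw [List.length_append]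
      omega

theorem span_mFam (n : ℕ) : Submodule.span ℤ[X] (Set.range (mFam n)) = ⊤ := by
  rw [eq_top_iff]
  rintro b -
  have h1 : (1 : TL n) ∈ Submodule.span ℤ[X] (mFam n '' pairsAbove n 0 0) := by
    simpa [qWord, vWord, pWord, tlStar_one] using
      qWord_mem_span (n := n) (A := []) (B := []) (f := 0) (g := 0) trivial trivial rfl trivial
        le_rfl
  have h2 := mul_mem_span_pairsAbove b 1 h1
  rw [one_mul] at h2
  exact Submodule.span_mono (Set.image_subset_range _ _) h2

theorem map_tlStar_span_pairsAbove_le (n g : ℕ) :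
    (Submodule.span ℤ[X] (mFam n '' pairsAbove n 0 g)).map (tlStar n) ≤
      Submodule.span ℤ[X] (mFam n '' pairsAbove n 0 g) := by
  rw [Submodule.map_span, Submodule.span_le]
  rintro _ ⟨_, ⟨⟨lam, s, t⟩, ⟨hg, -⟩, rfl⟩, rfl⟩
  refine Submodule.subset_span ⟨⟨lam, t, s⟩, ⟨hg, trivial⟩, ?_⟩
  exact (tlStar_m s t).symm

/-- Conjugate right multiplication by the anti-involution. This needs `f = 0`, since swapping the
tableaux does not respect a prefix condition on the first one. -/
theorem mul_mem_span_pairsAbove_left {g : ℕ} (b : TL n) {a : TL n}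
    (ha : a ∈ Submodule.span ℤ[X] (mFam n '' pairsAbove n 0 g)) :
    b * a ∈ Submodule.span ℤ[X] (mFam n '' pairsAbove n 0 g) := by
  have h := mul_mem_span_pairsAbove (tlStar n b) _
    (map_tlStar_span_pairsAbove_le n g (Submodule.mem_map_of_mem ha))
  have h' := map_tlStar_span_pairsAbove_le n g (Submodule.mem_map_of_mem h)
  rwa [tlStar_mul, tlStar_tlStar, tlStar_tlStar] at h'

/-- The list `o + 2, o + 4, …, o + 2f`. -/
def evens : ℕ → ℕ → List ℕ
  | _, 0 => []
  | o, f + 1 => (o + 2) :: evens (o + 2) f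

theorem length_evens (o f : ℕ) : (evens o f).length = f := by
  induction f generalizing o with
  | zero => rfl
  | succ f ih => simp [evens, ih]

theorem starts_evens (o f : ℕ) : Starts o f (evens o f) := by
  induction f generalizing o with
  | zero => trivial
  | succ f ih => exact ⟨rfl, ih _⟩

theorem valid_evens {o f : ℕ} (h : o + 2 * f ≤ n) : Valid n o (evens o f) := by
  induction f generalizing o with
  | zero => trivial
  | succ f ih => exact ⟨le_rfl, by omega, ih (by omega)⟩

theorem vWord_evens (o f : ℕ) : vWord n o (evens o f) = 1 :=
  vWord_eq_one (by rw [length_evens]; exact starts_evens o f)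

theorem pWord_eq_qWord_evens (L : List ℕ) : pWord n 0 L = qWord n (evens 0 L.length) L := by
  rw [qWord, vWord_evens, tlStar_one, one_mul]

theorem mShape_eq_qWord (lam : Partn n) :
    mShape lam = qWord n (evens 0 lam.1.1) (evens 0 lam.1.1) := by
  have := lam.2
  rw [qWord, vWord_evens, tlStar_one, one_mul, pWord_eq (valid_evens (by omega)), vWord_evens,
    length_evens, mul_one]
  rfl

theorem m_mem_idealOf {lam : Partn n} (s t : Tab n lam) : m s t ∈ idealOf lam :=
  TwoSidedIdeal.mul_mem_right _ _ _ (TwoSidedIdeal.mul_mem_left _ _ _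
    (TwoSidedIdeal.subset_span rfl))

theorem idealOf_le_idealCheck {lam mu : Partn n} (h : SDom mu lam) :
    idealOf mu ≤ idealCheck lam := le_iSup₂_of_le mu h le_rfl

theorem smul_mem_twoSidedIdeal (I : TwoSidedIdeal (TL n)) (r : ℤ[X]) {a : TL n} (ha : a ∈ I) :
    r • a ∈ I := by
  rw [Algebra.smul_def]
  exact I.mul_mem_left _ _ ha

theorem ring_mul_neg_one {A : Type*} [Ring A] (x : A) : x * -1 = -x := mul_neg_one x

/-- The span is itself a two-sided ideal and contains each higher `m_μ`, as the word of `2, 4, …` on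
both sides; conversely each `m_{st}` is a multiple of its `m_μ`. -/
theorem mem_idealCheck_iff_span_pairsAbove (lam : Partn n) (z : TL n) :
    z ∈ idealCheck lam ↔
      z ∈ Submodule.span ℤ[X] (mFam n '' pairsAbove n 0 (lam.1.1 + 1)) := by
  constructor
  · intro hz
    let I : TwoSidedIdeal (TL n) := TwoSidedIdeal.mk'
      (Submodule.span ℤ[X] (mFam n '' pairsAbove n 0 (lam.1.1 + 1)) : Set (TL n))
      (zero_mem _) (fun h h' => add_mem h h')
      (fun {x} h => by
        have h' : x * -1 ∈ _ := mul_mem_span_pairsAbove (-1) x h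
        have hx : x * -1 = -x := ring_mul_neg_one x
        exact hx ▸ h')
      (fun h => mul_mem_span_pairsAbove_left _ h) (fun h => mul_mem_span_pairsAbove _ _ h)
    have hI : idealCheck lam ≤ I := by
      refine iSup₂_le fun mu hmu => ?_
      rw [idealOf, TwoSidedIdeal.span_le]
      rintro _ rfl
      have := mu.2
      refine (TwoSidedIdeal.mem_mk' _ _ _ _ _ _ _).2 ?_
      rw [mShape_eq_qWord]
      refine qWord_mem_span (valid_evens (by omega)) (valid_evens (by omega)) rfl trivial ?_
      rw [length_evens]
      exact sDom_iff.1 hmu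
    exact (TwoSidedIdeal.mem_mk' _ _ _ _ _ _ _).1 (hI hz)
  · intro hz
    induction hz using Submodule.span_induction with
    | zero => exact zero_mem _
    | add a b _ _ ha hb => exact add_mem ha hb
    | smul r a _ ha => exact smul_mem_twoSidedIdeal _ r ha
    | mem a ha =>
      obtain ⟨⟨mu, s, t⟩, ⟨hg, -⟩, rfl⟩ := ha
      exact idealOf_le_idealCheck (sDom_iff.2 hg) (m_mem_idealOf s t)

theorem mem_idealCheck_iff (lam : Partn n) (z : TL n) :
    z ∈ idealCheck lam ↔ z ∈ Submodule.span ℤ[X]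
      {y | ∃ (mu : Partn n) (s t : Tab n mu), SDom mu lam ∧ y = m s t} := by
  rw [mem_idealCheck_iff_span_pairsAbove]
  have : mFam n '' pairsAbove n 0 (lam.1.1 + 1) =
      {y | ∃ (mu : Partn n) (s t : Tab n mu), SDom mu lam ∧ y = m s t} := by
    ext y
    constructor
    · rintro ⟨⟨mu, s, t⟩, ⟨hg, -⟩, rfl⟩
      exact ⟨mu, s, t, sDom_iff.2 hg, rfl⟩
    · rintro ⟨mu, s, t, h, rfl⟩
      exact ⟨⟨mu, s, t⟩, ⟨sDom_iff.1 h, trivial⟩, rfl⟩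
  rw [this]

theorem mem_tabAbove {f : ℕ} {mu : Partn n} {r : Tab n mu} (h : Starts 0 f (closers r)) :
    r ∈ tabAbove f mu := by
  have := vWord_mem_adjoin (valid_closers r) h
  rw [← v_eq, zero_add] at this
  exact this

theorem exists_mShape_mul_v_mul_eq (b : TL n) (lam : Partn n) (u : Tab n lam) :
    ∃ (a : Tab n lam → ℤ[X]) (c : (mu : Partn n) → Tab n mu → Tab n mu → ℤ[X]),
      (∀ (mu : Partn n) (r t : Tab n mu), c mu r t ≠ 0 →
        SDom mu lam ∧ r ∈ tabAbove lam.1.1 mu) ∧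
      mShape lam * v u * b =
        ∑ t, a t • (mShape lam * v t) + ∑ mu, ∑ r, ∑ t, c mu r t • m (lam := mu) r t := by
  classical
  have hlam := lam.2
  have h1 : mShape lam * v u ∈
      Submodule.span ℤ[X] (mFam n '' pairsAbove n lam.1.1 lam.1.1) := by
    rw [mShape_mul_v, pWord_eq_qWord_evens, length_closers]
    exact qWord_mem_span (valid_evens (by omega)) (valid_closers u)
      (by rw [length_evens, length_closers]) (starts_evens _ _) (length_closers u).ge
  have h2 := mul_mem_span_pairsAbove b _ h1
  rw [Finsupp.mem_span_image_iff_linearCombination] at h2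
  obtain ⟨l, hl, hlb⟩ := h2
  have hl' : ∀ p, l p ≠ 0 → p ∈ pairsAbove n lam.1.1 lam.1.1 := fun p hp =>
    (Finsupp.mem_supported _ _).1 hl (Finsupp.mem_support_iff.2 hp)
  -- In shape `lam` the prefix condition exhausts the closing positions of `r`, so every
  -- contributing `r` has `v_r = 1` and its term is `m_λ v_t`.
  refine ⟨fun t => ∑ r, l ⟨lam, r, t⟩, fun mu r t => if mu = lam then 0 else l ⟨mu, r, t⟩, ?_, ?_⟩
  · intro mu r t h
    by_cases hmu : mu = lam
    · simp [hmu] at h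
    · simp only [if_neg hmu] at h
      exact ⟨⟨(hl' _ h).1, hmu⟩, mem_tabAbove (hl' _ h).2⟩
  · have hsum : mShape lam * v u * b =
        ∑ mu, ∑ r, ∑ t, l ⟨mu, r, t⟩ • m (lam := mu) r t := by
      rw [← hlb, Finsupp.linearCombination_apply, Finsupp.sum_fintype _ _ (by simp),
        Fintype.sum_sigma]
      simp only [Fintype.sum_prod_type]
      rfl
    have hfirst : ∑ t, (∑ r, l ⟨lam, r, t⟩) • (mShape lam * v t) =
        ∑ r, ∑ t, l ⟨lam, r, t⟩ • m (lam := lam) r t := by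
      rw [Finset.sum_comm]
      refine Finset.sum_congr rfl fun t _ => ?_
      rw [Finset.sum_smul]
      refine Finset.sum_congr rfl fun r _ => ?_
      by_cases h : l ⟨lam, r, t⟩ = 0
      · rw [h, zero_smul, zero_smul]
      · have hr : Starts 0 (closers r).length (closers r) := by
          rw [length_closers]
          exact (hl' _ h).2
        rw [m, vStar_eq, vWord_eq_one hr, tlStar_one, one_mul]
    rw [hsum, hfirst, ← Finset.add_sum_erase _ _ (Finset.mem_univ lam),
      ← Finset.add_sum_erase (a := lam) Finset.univ
        (fun mu => ∑ r, ∑ t, (if mu = lam then (0 : ℤ[X]) else l ⟨mu, r, t⟩) • m (lam := mu) r t)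
        (Finset.mem_univ lam)]
    simp only [if_true, zero_smul, Finset.sum_const_zero, zero_add]
    congr 1
    refine Finset.sum_congr rfl fun mu hmu => ?_
    simp only [if_neg (Finset.ne_of_mem_erase hmu)]

/-- The coefficients come from `m_λ v_u b`, before `v_s^*` is multiplied on the left, so they do not
depend on `s`. -/
theorem exists_m_mul_sub_mem (b : TL n) (lam : Partn n) (u : Tab n lam) :
    ∃ a : Tab n lam → ℤ[X], ∀ s : Tab n lam,
      m s u * b - ∑ t, a t • m s t ∈ idealCheck lam := by
  obtain ⟨a, c, hc, h⟩ := exists_mShape_mul_v_mul_eq b lam u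
  refine ⟨a, fun s => ?_⟩
  have h1 : m s u * b - ∑ t, a t • m s t =
      vStar s * ∑ mu, ∑ r, ∑ t, c mu r t • m (lam := mu) r t := by
    refine sub_eq_of_eq_add' (G := TL n) ?_
    have h2 : ∑ t, a t • m s t = vStar s * ∑ t, a t • (mShape lam * v t) := by
      rw [Finset.mul_sum]
      simp only [m, mul_assoc, mul_smul_comm]
    rw [h2, m, mul_assoc, mul_assoc, ← mul_assoc (mShape lam), h]
    exact mul_add _ _ _
  rw [h1]
  refine TwoSidedIdeal.mul_mem_left _ _ _ ?_
  refine sum_mem fun mu _ => sum_mem fun r _ => sum_mem fun t _ => ?_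
  by_cases hz : c mu r t = 0
  · rw [hz, zero_smul]
    exact zero_mem _
  · exact smul_mem_twoSidedIdeal _ _
      (idealOf_le_idealCheck (hc mu r t hz).1 (m_mem_idealOf r t))

/-! ### The spin chain representation -/

/-- A field containing `ℤ[x]` and all square roots. -/
abbrev SpinField : Type := AlgebraicClosure (FractionRing ℤ[X])

theorem algebraMap_spinField_injective : Function.Injective (algebraMap ℤ[X] SpinField) := by
  rw [IsScalarTower.algebraMap_eq ℤ[X] (FractionRing ℤ[X]) SpinField]
  exact (algebraMap (FractionRing ℤ[X]) SpinField).injective.comp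
    (IsFractionRing.injective ℤ[X] (FractionRing ℤ[X]))

/-- A closed loop collects the square of a weight for each of its two orientations, so weights `q`
and `q⁻¹` give it the value `q² + q⁻²`. -/
theorem exists_spin_param : ∃ q : SpinField, q ≠ 0 ∧
    q * q + q⁻¹ * q⁻¹ = algebraMap ℤ[X] SpinField X := by
  let x := algebraMap ℤ[X] SpinField X
  -- `q²` is to be a root of `t² - x t + 1`, whose discriminant is `x² - 4`.
  obtain ⟨d, hd⟩ := IsAlgClosed.exists_pow_nat_eq (x * x - 4) (n := 2) (by norm_num)
  obtain ⟨q, hq⟩ := IsAlgClosed.exists_pow_nat_eq ((x + d) / 2) (n := 2) (by norm_num)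
  have h2 : (2 : SpinField) ≠ 0 := by
    have : CharZero (FractionRing ℤ[X]) := inferInstance
    have : CharZero SpinField := charZero_of_injective_algebraMap
      (algebraMap (FractionRing ℤ[X]) SpinField).injective
    exact two_ne_zero
  have h : (q ^ 2) * (q ^ 2) + 1 = x * q ^ 2 := by
    rw [hq]
    field_simp
    linear_combination hd
  have hq0 : q ≠ 0 := by
    rintro rfl
    simp at h
  refine ⟨q, hq0, ?_⟩
  change _ = x
  field_simp
  linear_combination h

/-- A square root of the quantum parameter. -/
noncomputable def spinParam : SpinField := exists_spin_param.choose

theorem spinParam_ne_zero : spinParam ≠ 0 := exists_spin_param.choose_spec.1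

theorem spinParam_spec : spinParam * spinParam + spinParam⁻¹ * spinParam⁻¹ =
    algebraMap ℤ[X] SpinField X := exists_spin_param.choose_spec.2

/-- The weight of a cup or cap whose left end has spin `b`. -/
noncomputable def weight (b : Bool) : SpinField := if b then spinParam⁻¹ else spinParam

theorem weight_ne_zero (b : Bool) : weight b ≠ 0 := by
  cases b <;> simp [weight, spinParam_ne_zero]

theorem weight_mul_weight_not (b : Bool) : weight b * weight (!b) = 1 := by
  cases b <;> simp [weight, spinParam_ne_zero]

/-- Functions on infinite spin configurations. -/
abbrev Spin : Type := (ℕ → Bool) → SpinField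

/-- Insert two spins at the positions `i` and `i + 1`. -/
def insertPair (i : ℕ) (b c : Bool) (ε : ℕ → Bool) : ℕ → Bool := fun j =>
  if j < i then ε j else if j = i then b else if j = i + 1 then c else ε (j - 2)

/-- Delete the spins at the positions `i` and `i + 1`. -/
def deletePair (i : ℕ) (ε : ℕ → Bool) : ℕ → Bool := fun j => if j < i then ε j else ε (j + 2)

theorem insertPair_left (i : ℕ) (b c : Bool) (ε : ℕ → Bool) : insertPair i b c ε i = b := by
  simp [insertPair]

theorem insertPair_right (i : ℕ) (b c : Bool) (ε : ℕ → Bool) :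
    insertPair i b c ε (i + 1) = c := by
  simp [insertPair]

theorem deletePair_insertPair (i : ℕ) (b c : Bool) (ε : ℕ → Bool) :
    deletePair i (insertPair i b c ε) = ε := by
  funext j
  simp only [deletePair, insertPair]
  grind

theorem insertPair_deletePair (i : ℕ) (ε : ℕ → Bool) :
    insertPair i (ε i) (ε (i + 1)) (deletePair i ε) = ε := by
  funext j
  simp only [deletePair, insertPair]
  grind

/-- The cap joining the positions `i` and `i + 1`. -/
noncomputable def cap (i : ℕ) : Module.End ℤ[X] Spin where
  toFun φ ε := weight false * φ (insertPair i false true ε) +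
    weight true * φ (insertPair i true false ε)
  map_add' φ ψ := by funext ε; simp only [Pi.add_apply]; ring
  map_smul' r φ := by
    funext ε
    simp only [Pi.smul_apply, RingHom.id_apply, mul_smul_comm, smul_add]

/-- The cup joining the positions `i` and `i + 1`. -/
noncomputable def cup (i : ℕ) : Module.End ℤ[X] Spin where
  toFun φ ε := if ε (i + 1) = !(ε i) then weight (ε i) * φ (deletePair i ε) else 0
  map_add' φ ψ := by funext ε; simp only [Pi.add_apply]; split_ifs <;> ring
  map_smul' r φ := by
    funext ε
    simp only [Pi.smul_apply, RingHom.id_apply]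
    split_ifs <;> simp

theorem cap_apply (i : ℕ) (φ : Spin) (ε : ℕ → Bool) :
    cap i φ ε = weight false * φ (insertPair i false true ε) +
      weight true * φ (insertPair i true false ε) := rfl

theorem cup_apply (i : ℕ) (φ : Spin) (ε : ℕ → Bool) :
    cup i φ ε = if ε (i + 1) = !(ε i) then weight (ε i) * φ (deletePair i ε) else 0 := rfl

theorem cup_insertPair (i : ℕ) (b : Bool) (φ : Spin) (ε : ℕ → Bool) :
    cup i φ (insertPair i b (!b) ε) = weight b * φ ε := by
  rw [cup_apply, insertPair_left, insertPair_right, if_pos rfl, deletePair_insertPair]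

theorem cap_mul_cup (i : ℕ) : cap i * cup i = (X : ℤ[X]) • (1 : Module.End ℤ[X] Spin) := by
  ext φ ε
  have h1 := cup_insertPair i false φ ε
  have h2 := cup_insertPair i true φ ε
  simp only [Bool.not_false, Bool.not_true] at h1 h2
  change _ = (X : ℤ[X]) • φ ε
  rw [Algebra.smul_def, ← spinParam_spec, Module.End.mul_apply, cap_apply, h1, h2]
  simp only [weight, if_true, Bool.false_eq_true, if_false]
  ring

/-- A zigzag straightens: only one spin choice survives in the cap, and it collects the opposite
weights `q` and `q⁻¹`. -/
theorem cap_succ_mul_cup (i : ℕ) : cap (i + 1) * cup i = 1 := by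
  ext φ ε
  have h0 : ∀ b c, insertPair (i + 1) b c ε i = ε i := by simp [insertPair]
  have h1 : ∀ b, b = ε i → deletePair i (insertPair (i + 1) (!b) b ε) = ε := by
    rintro b rfl
    funext j
    simp only [deletePair, insertPair]
    grind
  have h2 := h1 true
  have h3 := h1 false
  have h4 := weight_mul_weight_not true
  have h5 := weight_mul_weight_not false
  simp only [Bool.not_false, Bool.not_true] at h2 h3 h4 h5
  simp only [Module.End.mul_apply, cap_apply, cup_apply, insertPair_left, h0, Module.End.one_apply]
  cases h : ε i
  · rw [h3 h.symm]
    simp [← mul_assoc, h4]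
  · rw [h2 h.symm]
    simp [← mul_assoc, h5]

theorem cap_mul_cup_succ (i : ℕ) : cap i * cup (i + 1) = 1 := by
  ext φ ε
  have h0 : ∀ b c, insertPair i b c ε (i + 1 + 1) = ε i := by
    intros
    simp only [insertPair]
    grind
  have h1 : ∀ b, b = ε i → deletePair (i + 1) (insertPair i b (!b) ε) = ε := by
    rintro b rfl
    funext j
    simp only [deletePair, insertPair]
    grind
  have h2 := h1 true
  have h3 := h1 false
  have h4 := weight_mul_weight_not true
  have h5 := weight_mul_weight_not false
  simp only [Bool.not_false, Bool.not_true] at h2 h3 h4 h5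
  simp only [Module.End.mul_apply, cap_apply, cup_apply, insertPair_right, h0, Module.End.one_apply]
  cases h : ε i
  · rw [h3 h.symm]
    simp [← mul_assoc, h5]
  · rw [h2 h.symm]
    simp [← mul_assoc, h4]

theorem cap_mul_cup_of_le {i j : ℕ} (h : i ≤ j) : cap i * cup (j + 2) = cup j * cap i := by
  ext φ ε
  have h0 : ∀ b c, insertPair i b c ε (j + 2) = ε j := by intros; simp only [insertPair]; grind
  have h1 : ∀ b c, insertPair i b c ε (j + 2 + 1) = ε (j + 1) := by
    intros; simp only [insertPair]; grind
  have h2 : ∀ b c, deletePair (j + 2) (insertPair i b c ε) = insertPair i b c (deletePair j ε) := by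
    intro b c
    funext l
    simp only [deletePair, insertPair]
    grind
  simp only [Module.End.mul_apply, cap_apply, cup_apply, h0, h1, h2]
  split_ifs <;> ring

theorem cap_mul_cup_of_ge {i j : ℕ} (h : i ≤ j) : cap (j + 2) * cup i = cup i * cap j := by
  ext φ ε
  have h0 : ∀ b c, insertPair (j + 2) b c ε i = ε i := by intros; simp only [insertPair]; grind
  have h1 : ∀ b c, insertPair (j + 2) b c ε (i + 1) = ε (i + 1) := by
    intros; simp only [insertPair]; grind
  have h2 : ∀ b c, deletePair i (insertPair (j + 2) b c ε) = insertPair j b c (deletePair i ε) := by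
    intro b c
    funext l
    simp only [deletePair, insertPair]
    grind
  simp only [Module.End.mul_apply, cap_apply, cup_apply, h0, h1, h2]
  split_ifs <;> ring

theorem cup_mul_cup {i j : ℕ} (h : i ≤ j) : cup (j + 2) * cup i = cup i * cup j := by
  ext φ ε
  have h0 : deletePair (j + 2) ε i = ε i := by simp only [deletePair]; grind
  have h1 : deletePair (j + 2) ε (i + 1) = ε (i + 1) := by simp only [deletePair]; grind
  have h2 : deletePair i ε j = ε (j + 2) := by simp only [deletePair]; grind
  have h3 : deletePair i ε (j + 1) = ε (j + 2 + 1) := by simp only [deletePair]; grind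
  have h4 : deletePair i (deletePair (j + 2) ε) = deletePair j (deletePair i ε) := by
    funext l
    simp only [deletePair]
    grind
  simp only [Module.End.mul_apply, cup_apply, h0, h1, h2, h3, h4]
  split_ifs <;> ring

theorem cap_mul_cap {i j : ℕ} (h : i ≤ j) : cap j * cap i = cap i * cap (j + 2) := by
  ext φ ε
  have h0 : ∀ b c b' c', insertPair i b c (insertPair j b' c' ε) =
      insertPair (j + 2) b' c' (insertPair i b c ε) := by
    intros
    funext l
    simp only [insertPair]
    grind
  simp only [Module.End.mul_apply, cap_apply, h0]
  ring

theorem commute_cup_cap {i j : ℕ} (h : i ≤ j) :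
    (cup i * cap i) * (cup (j + 2) * cap (j + 2)) =
      (cup (j + 2) * cap (j + 2)) * (cup i * cap i) := by
  rw [mul_assoc, ← mul_assoc (cap i), cap_mul_cup_of_le h, mul_assoc (cup j), ← cap_mul_cap h,
    ← mul_assoc, ← cup_mul_cup h, mul_assoc, ← mul_assoc (cup i), ← cap_mul_cup_of_ge h]
  simp only [mul_assoc]

/-- The spin chain representation of `A_n(x)`. -/
noncomputable def spinRep (n : ℕ) : TL n →ₐ[ℤ[X]] Module.End ℤ[X] Spin :=
  RingQuot.liftAlgHom ℤ[X] ⟨FreeAlgebra.lift ℤ[X] fun i : Idx n => cup i.1 * cap i.1, by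
    intro a b hab
    induction hab with
    | sq i =>
      simp only [map_mul, map_smul, FreeAlgebra.lift_ι_apply]
      rw [mul_assoc, ← mul_assoc (cap _), cap_mul_cup, smul_mul_assoc, one_mul, mul_smul_comm]
    | adj i j h =>
      simp only [map_mul, FreeAlgebra.lift_ι_apply]
      rcases h with h | h
      · rw [h, mul_assoc, mul_assoc, mul_assoc, ← mul_assoc (cap (i.1 + 1)), cap_succ_mul_cup,
          one_mul, ← mul_assoc (cap i.1), cap_mul_cup_succ, one_mul]
      · rw [h, mul_assoc, mul_assoc, mul_assoc, ← mul_assoc (cap j.1) (cup (j.1 + 1)),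
          cap_mul_cup_succ, one_mul, ← mul_assoc (cap (j.1 + 1)), cap_succ_mul_cup, one_mul]
    | comm i j h =>
      simp only [map_mul, FreeAlgebra.lift_ι_apply]
      rcases h with h | h
      · obtain ⟨d, hd⟩ := Nat.exists_eq_add_of_le h
        rw [hd, show i.1 + 2 + d = i.1 + d + 2 by ring]
        exact commute_cup_cap (by omega)
      · obtain ⟨d, hd⟩ := Nat.exists_eq_add_of_le h
        rw [hd, show j.1 + 2 + d = j.1 + d + 2 by ring]
        exact (commute_cup_cap (by omega)).symm⟩

theorem spinRep_e {i : ℕ} (h1 : 1 ≤ i) (h2 : i < n) : spinRep n (e n i) = cup i * cap i := by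
  rw [e_of_mem ⟨h1, h2⟩, spinRep, RingQuot.liftAlgHom_mkAlgHom_apply, FreeAlgebra.lift_ι_apply]

/-- All inner caps and cups cancel as zigzags. -/
theorem spinRep_seg {a c : ℕ} (ha : 1 ≤ a) (hac : a ≤ c) (hc : c < n) :
    spinRep n (seg n a (c + 1)) = cup a * cap c := by
  induction c, hac using Nat.le_induction with
  | base => rw [seg_self_succ, spinRep_e ha hc]
  | succ c hac ih =>
    rw [← seg_mul_e (by omega), map_mul, ih (by omega), spinRep_e (by omega) hc, mul_assoc,
      ← mul_assoc (cap c), cap_mul_cup_succ, one_mul]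

theorem spinRep_tlStar_seg {a c : ℕ} (ha : 1 ≤ a) (hac : a ≤ c) (hc : c < n) :
    spinRep n (tlStar n (seg n a (c + 1))) = cup c * cap a := by
  induction c, hac using Nat.le_induction with
  | base => rw [seg_self_succ, tlStar_e, spinRep_e ha hc]
  | succ c hac ih =>
    rw [← seg_mul_e (by omega), tlStar_mul, map_mul, ih (by omega), tlStar_e,
      spinRep_e (by omega) hc, mul_assoc, ← mul_assoc (cap (c + 1)), cap_succ_mul_cup, one_mul]

/-- The product of the cups prescribed by a list of closing positions. -/
noncomputable def cups : ℕ → List ℕ → Module.End ℤ[X] Spin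
  | _, [] => 1
  | o, k :: L => cup (k - 1 - o) * cups (o + 2) L

/-- The product of the caps prescribed by a list of closing positions. -/
noncomputable def caps : ℕ → List ℕ → Module.End ℤ[X] Spin
  | _, [] => 1
  | o, k :: L => caps (o + 2) L * cap (k - 1 - o)

/-- The product `cup_{2g-1} ⋯ cup_3 cup_1`. -/
noncomputable def oddCups : ℕ → Module.End ℤ[X] Spin
  | 0 => 1
  | g + 1 => cup (2 * g + 1) * oddCups g

theorem cups_append (o k : ℕ) (L : List ℕ) :
    cups o (L ++ [k]) = cups o L * cup (k - 1 - (o + 2 * L.length)) := by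
  induction L generalizing o with
  | nil => simp [cups]
  | cons a L ih =>
    rw [List.cons_append, cups, ih, cups, mul_assoc, List.length_cons,
      show o + 2 + 2 * L.length = o + 2 * (L.length + 1) by ring]

theorem caps_append (o k : ℕ) (L : List ℕ) :
    caps o (L ++ [k]) = cap (k - 1 - (o + 2 * L.length)) * caps o L := by
  induction L generalizing o with
  | nil => simp [caps]
  | cons a L ih =>
    rw [List.cons_append, caps, ih, caps, mul_assoc, List.length_cons,
      show o + 2 + 2 * L.length = o + 2 * (L.length + 1) by ring]

theorem cap_mul_oddCups (g j : ℕ) :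
    cap (2 * g + 1 + j) * oddCups g = oddCups g * cap (j + 1) := by
  induction g generalizing j with
  | zero => simp [oddCups, add_comm]
  | succ g ih =>
    rw [oddCups, ← mul_assoc, show 2 * (g + 1) + 1 + j = 2 * g + 1 + j + 2 by ring,
      cap_mul_cup_of_ge (by omega), mul_assoc, ih, mul_assoc]

theorem cup_mul_oddCups (g j : ℕ) :
    cup (2 * g + 1 + j) * oddCups g = oddCups g * cup (j + 1) := by
  induction g generalizing j with
  | zero => simp [oddCups, add_comm]
  | succ g ih =>
    rw [oddCups, ← mul_assoc, show 2 * (g + 1) + 1 + j = 2 * g + 1 + j + 2 by ring,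
      cup_mul_cup (by omega), mul_assoc, ih, mul_assoc]

/-- The lower half of the diagram becomes the caps of `L`, while the upper half is the row of
adjacent cups at `1, 3, …`; `spinRep_tlStar_vWord` then turns that row into the cups of the left
list. -/
theorem spinRep_pWord {L : List ℕ} (hL : Valid n 0 L) :
    spinRep n (pWord n 0 L) = oddCups L.length * caps 0 L := by
  induction L using List.reverseRecOn with
  | nil => simp [pWord, oddCups, caps]
  | append_singleton L k ih =>
    obtain ⟨h1, h2, h3⟩ := valid_append.1 hL
    obtain ⟨j, rfl⟩ : ∃ j, k = 2 * L.length + 1 + j + 1 := ⟨k - 2 * L.length - 2, by omega⟩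
    rw [pWord_append, map_mul, ih h1, spinRep_seg (by omega) (by omega) (by omega), caps_append,
      List.length_append, List.length_singleton, oddCups, mul_assoc, ← mul_assoc (cap _),
      cap_mul_oddCups, mul_assoc, mul_assoc, zero_add,
      show 2 * L.length + 1 + j + 1 - 1 - (2 * L.length) = j + 1 by omega]

theorem spinRep_tlStar_vWord {L : List ℕ} (hL : Valid n 0 L) :
    spinRep n (tlStar n (vWord n 0 L)) * oddCups L.length = cups 0 L := by
  induction L using List.reverseRecOn with
  | nil => simp [vWord, tlStar_one, oddCups, cups]
  | append_singleton L k ih =>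
    obtain ⟨h1, h2, h3⟩ := valid_append.1 hL
    obtain ⟨j, rfl⟩ : ∃ j, k = 2 * L.length + 1 + j + 1 := ⟨k - 2 * L.length - 2, by omega⟩
    have key : spinRep n (tlStar n (seg n (2 * L.length + 2) (2 * L.length + 1 + j + 1))) *
        cup (2 * L.length + 1) = cup (2 * L.length + 1 + j) := by
      -- For `j = 0` the segment is empty, and its image is the identity rather than a cup times a
      -- cap.
      rcases Nat.eq_zero_or_pos j with rfl | hj
      · rw [seg_of_le (by omega), tlStar_one, map_one, one_mul, add_zero]
      · rw [spinRep_tlStar_seg (by omega) (by omega) (by omega), mul_assoc, cap_succ_mul_cup,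
          mul_one]
    rw [vWord_append, tlStar_mul, map_mul, cups_append, List.length_append, List.length_singleton,
      oddCups, mul_assoc, ← mul_assoc _ (cup _), zero_add, key, cup_mul_oddCups, ← mul_assoc,
      ih h1, show 2 * L.length + 1 + j + 1 - 1 - (2 * L.length) = j + 1 by omega]

theorem spinRep_qWord {A B : List ℕ} (hA : Valid n 0 A) (hB : Valid n 0 B)
    (h : A.length = B.length) : spinRep n (qWord n A B) = cups 0 A * caps 0 B := by
  rw [qWord, map_mul, spinRep_pWord hB, ← mul_assoc, ← h, spinRep_tlStar_vWord hA]

/-! ### Triangularity -/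

/-- The number of spins `true` at positions less than `p`. -/
def prefixCount (ε : ℕ → Bool) : ℕ → ℕ
  | 0 => 0
  | p + 1 => prefixCount ε p + (ε p).toNat

/-- Comparison of the numbers of spins `true` in all prefixes. -/
def PrefixLE (ε δ : ℕ → Bool) : Prop := ∀ p, prefixCount ε p ≤ prefixCount δ p

theorem PrefixLE.refl (ε : ℕ → Bool) : PrefixLE ε ε := fun _ => le_rfl

theorem PrefixLE.antisymm {ε δ : ℕ → Bool} (h : PrefixLE ε δ) (h' : PrefixLE δ ε) : ε = δ := by
  have h0 : ∀ p, prefixCount ε p = prefixCount δ p := fun p => le_antisymm (h p) (h' p)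
  funext p
  have h1 := h0 (p + 1)
  rw [prefixCount, prefixCount, h0 p] at h1
  cases h2 : ε p <;> cases h3 : δ p <;> simp_all

theorem prefixCount_insertPair_of_le (i : ℕ) (b c : Bool) (ε : ℕ → Bool) {p : ℕ} (h : p ≤ i) :
    prefixCount (insertPair i b c ε) p = prefixCount ε p := by
  induction p with
  | zero => rfl
  | succ p ih =>
    rw [prefixCount, prefixCount, ih (by omega), insertPair, if_pos (by omega)]

theorem prefixCount_insertPair_succ (i : ℕ) (b c : Bool) (ε : ℕ → Bool) :
    prefixCount (insertPair i b c ε) (i + 1) = prefixCount ε i + b.toNat := by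
  rw [prefixCount, prefixCount_insertPair_of_le _ _ _ _ le_rfl, insertPair_left]

theorem prefixCount_insertPair_of_ge (i : ℕ) (b c : Bool) (ε : ℕ → Bool) {p : ℕ} (h : i ≤ p) :
    prefixCount (insertPair i b c ε) (p + 2) = prefixCount ε p + b.toNat + c.toNat := by
  induction p, h using Nat.le_induction with
  | base => rw [prefixCount, prefixCount_insertPair_succ, insertPair_right]
  | succ p hp ih =>
    have h1 : insertPair i b c ε (p + 2) = ε p := by
      simp only [insertPair]
      grind
    rw [show p + 1 + 2 = p + 2 + 1 by ring, prefixCount, ih, prefixCount, h1]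
    ring

/-- Among the two opposite pairs, `(false, true)` delays its `true` and so has the smaller prefix
counts. -/
theorem PrefixLE.insertPair {ε δ : ℕ → Bool} (h : PrefixLE ε δ) (i : ℕ) (b : Bool) :
    PrefixLE (insertPair i false true ε) (insertPair i b (!b) δ) := by
  intro p
  rcases lt_trichotomy p (i + 1) with hp | rfl | hp
  · rw [prefixCount_insertPair_of_le _ _ _ _ (by omega),
      prefixCount_insertPair_of_le _ _ _ _ (by omega)]
    exact h p
  · rw [prefixCount_insertPair_succ, prefixCount_insertPair_succ]
    have := h i
    simp
    omega
  · obtain ⟨p, rfl⟩ : ∃ p', p = p' + 2 := ⟨p - 2, by omega⟩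
    rw [prefixCount_insertPair_of_ge _ _ _ _ (by omega),
      prefixCount_insertPair_of_ge _ _ _ _ (by omega)]
    have := h p
    cases b <;> simp <;> omega

/-- The configuration obtained from `ρ` by inserting a pair `(false, true)` for every arc. -/
def config : ℕ → List ℕ → (ℕ → Bool) → (ℕ → Bool)
  | _, [], ρ => ρ
  | o, k :: L, ρ => insertPair (k - 1 - o) false true (config (o + 2) L ρ)

theorem PrefixLE.config {ε δ : ℕ → Bool} (h : PrefixLE ε δ) (o : ℕ) (L : List ℕ) :
    PrefixLE (config o L ε) (config o L δ) := by
  induction L generalizing o with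
  | nil => exact h
  | cons k L ih => exact (ih (o + 2)).insertPair _ false

theorem cups_apply_config (o : ℕ) (L : List ℕ) (ψ : Spin) (ρ : ℕ → Bool) :
    cups o L ψ (config o L ρ) = weight false ^ L.length * ψ ρ := by
  induction L generalizing o with
  | nil => simp [cups, config]
  | cons k L ih =>
    rw [cups, config, Module.End.mul_apply, ← Bool.not_false, cup_insertPair, ih,
      List.length_cons]
    ring

/-- On the support every arc carries opposite spins. Turning each into `(false, true)` and all
remaining spins into `false` can only lower prefix counts. -/
theorem prefixLE_of_cups_ne_zero {o : ℕ} {L : List ℕ} {ψ : Spin} {ε : ℕ → Bool}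
    (h : cups o L ψ ε ≠ 0) : PrefixLE (config o L fun _ => false) ε := by
  induction L generalizing o ε with
  | nil =>
    intro p
    have : prefixCount (fun _ => false) p = 0 := by
      induction p with
      | zero => rfl
      | succ p ih => simp [prefixCount, ih]
    rw [config, this]
    exact Nat.zero_le _
  | cons k L ih =>
    rw [cups, Module.End.mul_apply, cup_apply] at h
    split_ifs at h with hε
    · have h1 := (ih (right_ne_zero_of_mul h)).insertPair (k - 1 - o) (ε (k - 1 - o))
      rwa [← hε, insertPair_deletePair] at h1
    · exact absurd rfl h

/-- The value at `ρ` only involves values of `φ` at configurations that add one opposite pair per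
arc, and the least of these is `config o L ρ`. -/
theorem caps_apply_eq_zero {o : ℕ} {L : List ℕ} {φ : Spin} {ρ : ℕ → Bool}
    (h : ∀ ε, PrefixLE (config o L ρ) ε → φ ε = 0) : caps o L φ ρ = 0 := by
  induction L generalizing o φ with
  | nil => exact h ρ (PrefixLE.refl ρ)
  | cons k L ih =>
    rw [caps, Module.End.mul_apply]
    refine ih fun ε hε => ?_
    have h1 := h _ (hε.insertPair _ false)
    have h2 := h _ (hε.insertPair _ true)
    simp only [Bool.not_false, Bool.not_true] at h1 h2
    rw [cap_apply, h1, h2, mul_zero, mul_zero, add_zero]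

open Classical in
/-- The indicator function of a configuration. -/
noncomputable def delta (ε : ℕ → Bool) : Spin := fun δ => if δ = ε then 1 else 0

theorem prefixLE_of_caps_ne_zero {o : ℕ} {L : List ℕ} {ε ρ : ℕ → Bool}
    (h : caps o L (delta ε) ρ ≠ 0) : PrefixLE (config o L ρ) ε := by
  by_contra hn
  refine h (caps_apply_eq_zero fun δ hδ => ?_)
  have : δ ≠ ε := by
    rintro rfl
    exact hn hδ
  simp [delta, this]

theorem cap_delta_insertPair (i : ℕ) (ε : ℕ → Bool) :
    cap i (delta (insertPair i false true ε)) = weight false • delta ε := by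
  funext δ
  rw [cap_apply, Pi.smul_apply, smul_eq_mul]
  have h1 : insertPair i true false δ ≠ insertPair i false true ε := fun h => by
    simpa [insertPair_left] using congrFun h i
  have h2 : insertPair i false true δ = insertPair i false true ε ↔ δ = ε :=
    ⟨fun h => by
      rw [← deletePair_insertPair i false true δ, h, deletePair_insertPair], fun h => by rw [h]⟩
  by_cases h : δ = ε
  · subst h
    simp [delta, h1]
  · simp [delta, h1, h2, h]

theorem cap_smul (i : ℕ) (c : SpinField) (φ : Spin) : cap i (c • φ) = c • cap i φ := by
  funext ε
  simp only [cap_apply, Pi.smul_apply, smul_eq_mul]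
  ring

theorem caps_smul (o : ℕ) (L : List ℕ) (c : SpinField) (φ : Spin) :
    caps o L (c • φ) = c • caps o L φ := by
  induction L generalizing o φ with
  | nil => rfl
  | cons k L ih => rw [caps, Module.End.mul_apply, cap_smul, ih, Module.End.mul_apply]

theorem caps_delta_config (o : ℕ) (L : List ℕ) (ρ : ℕ → Bool) :
    caps o L (delta (config o L ρ)) = weight false ^ L.length • delta ρ := by
  induction L generalizing o with
  | nil => simp [caps, config]
  | cons k L ih =>
    rw [caps, config, Module.End.mul_apply, cap_delta_insertPair, caps_smul, ih, smul_smul,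
      List.length_cons, pow_succ']

/-- The offset `o` counts the positions already removed with earlier arcs. Since the list is
increasing, later insertions stay to the right of the current `true`. -/
theorem config_eq_true_iff {o : ℕ} {L : List ℕ} (hL : Valid n o L) (hs : L.Pairwise (· < ·))
    (j : ℕ) : config o L (fun _ => false) j = true ↔ j + o ∈ L := by
  induction L generalizing o j with
  | nil => simp [config]
  | cons k L ih =>
    obtain ⟨h1, h2, h3⟩ := hL
    rw [List.pairwise_cons] at hs
    have ih' := ih h3 hs.2
    rw [config, insertPair, List.mem_cons]
    split_ifs with ha hb hc
    · rw [ih']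
      constructor
      · intro h
        have := hs.1 _ h
        omega
      · rintro (h | h)
        · omega
        · have := hs.1 _ h
          omega
    · simp only [false_iff]
      rintro (h | h)
      · omega
      · have := hs.1 _ h
        omega
    · simp only [true_iff]
      omega
    · rw [ih', show j - 2 + (o + 2) = j + o by omega]
      constructor
      · exact Or.inr
      · rintro (h | h)
        · omega
        · exact h

/-- The spin configuration of a tableau. -/
def tabConfig {lam : Partn n} (t : Tab n lam) : ℕ → Bool := config 0 (closers t) fun _ => false

theorem closers_eq_of_tabConfig_eq {lam mu : Partn n} {s : Tab n lam} {t : Tab n mu}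
    (h : tabConfig s = tabConfig t) : closers s = closers t := by
  refine List.Perm.eq_of_pairwise' (pairwise_closers s) (pairwise_closers t) ?_
  refine (List.perm_ext_iff_of_nodup ((pairwise_closers s).imp fun h => h.ne)
    ((pairwise_closers t).imp fun h => h.ne)).2 fun j => ?_
  have h1 := config_eq_true_iff (valid_closers s) (pairwise_closers s) j
  have h2 := config_eq_true_iff (valid_closers t) (pairwise_closers t) j
  rw [add_zero] at h1 h2
  rw [← h1, ← h2]
  exact iff_of_eq (congrArg (fun ε : ℕ → Bool => ε j = true) h)

theorem pairs_ext {p q : Pairs n} (h1 : tabConfig p.2.1 = tabConfig q.2.1)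
    (h2 : tabConfig p.2.2 = tabConfig q.2.2) : p = q := by
  obtain ⟨lam, s, t⟩ := p
  obtain ⟨mu, s', t'⟩ := q
  have hs := closers_eq_of_tabConfig_eq h1
  have ht := closers_eq_of_tabConfig_eq h2
  simp only at hs ht
  obtain rfl : lam = mu := Partn.ext_fst (by rw [← length_closers s, hs, length_closers])
  rw [closers_injective hs, closers_injective ht]

/-- The matrix coefficient of `a` at the configurations of the pair `p`. -/
noncomputable def coeffAt (p : Pairs n) : TL n →ₗ[ℤ[X]] SpinField :=
  LinearMap.proj (tabConfig p.2.1) ∘ₗ LinearMap.applyₗ (delta (tabConfig p.2.2)) ∘ₗ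
    (spinRep n).toLinearMap

theorem coeffAt_mFam (p q : Pairs n) : coeffAt p (mFam n q) =
    cups 0 (closers q.2.1) (caps 0 (closers q.2.2) (delta (tabConfig p.2.2)))
      (tabConfig p.2.1) := by
  have h : spinRep n (mFam n q) = cups 0 (closers q.2.1) * caps 0 (closers q.2.2) := by
    rw [mFam, m_eq_qWord, spinRep_qWord (valid_closers _) (valid_closers _)
      (by rw [length_closers, length_closers])]
  change (spinRep n (mFam n q)) _ _ = _
  rw [h]
  rfl

theorem coeffAt_self (p : Pairs n) : coeffAt p (mFam n p) ≠ 0 := by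
  rw [coeffAt_mFam, tabConfig, tabConfig, cups_apply_config, caps_delta_config, Pi.smul_apply]
  simp [delta, weight_ne_zero]

theorem prefixLE_of_coeffAt_ne_zero {p q : Pairs n} (h : coeffAt p (mFam n q) ≠ 0) :
    PrefixLE (tabConfig q.2.1) (tabConfig p.2.1) ∧
      (tabConfig q.2.1 = tabConfig p.2.1 → PrefixLE (tabConfig q.2.2) (tabConfig p.2.2)) := by
  rw [coeffAt_mFam] at h
  refine ⟨prefixLE_of_cups_ne_zero h, fun heq => ?_⟩
  -- At its own configuration the cup part is a power of a weight times evaluation at the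
  -- all-`false` configuration, which isolates the caps.
  rw [← heq, show tabConfig q.2.1 = config 0 (closers q.2.1) fun _ => false from rfl,
    cups_apply_config] at h
  exact prefixLE_of_caps_ne_zero (right_ne_zero_of_mul h)

theorem PrefixLE.trans {ε δ γ : ℕ → Bool} (h : PrefixLE ε δ) (h' : PrefixLE δ γ) :
    PrefixLE ε γ := fun p => (h p).trans (h' p)

/-- The lexicographic order on pairs of tableaux through their configurations. -/
def pairLT (q p : Pairs n) : Prop :=
  (PrefixLE (tabConfig q.2.1) (tabConfig p.2.1) ∧
    (tabConfig q.2.1 = tabConfig p.2.1 → PrefixLE (tabConfig q.2.2) (tabConfig p.2.2))) ∧ q ≠ p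

theorem wellFounded_pairLT : WellFounded (pairLT (n := n)) := by
  have h1 : IsTrans (Pairs n) pairLT := ⟨by
    rintro a b c ⟨⟨h1, h2⟩, h3⟩ ⟨⟨h1', h2'⟩, h3'⟩
    refine ⟨⟨h1.trans h1', fun h => ?_⟩, ?_⟩
    · have h4 : tabConfig a.2.1 = tabConfig b.2.1 := h1.antisymm (h ▸ h1')
      exact (h2 h4).trans (h2' (h4 ▸ h))
    · rintro rfl
      have h4 : tabConfig a.2.1 = tabConfig b.2.1 := h1.antisymm h1'
      exact h3 (pairs_ext h4 ((h2 h4).antisymm (h2' h4.symm)))⟩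
  have h2 : Std.Irrefl (pairLT (n := n)) := ⟨fun a h => h.2 rfl⟩
  exact Finite.wellFounded_of_trans_of_irrefl _

/-- Apply `coeffAt p` to a relation: terms below `p` vanish by induction, other terms off the
diagonal have zero coefficient, and the diagonal coefficient is nonzero in a field into which `ℤ[X]`
embeds. -/
theorem linearIndependent_mFam (n : ℕ) : LinearIndependent ℤ[X] (mFam n) := by
  refine (Fintype.linearIndependent_iff (R := ℤ[X]) (v := mFam n)).2 ?_
  intro g hg p
  induction p using wellFounded_pairLT.induction with
  | h p ih =>
  have h := congrArg (coeffAt p) hg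
  rw [map_sum, map_zero, Finset.sum_eq_single p] at h
  · rw [map_smul, Algebra.smul_def, mul_eq_zero] at h
    exact (map_eq_zero_iff _ algebraMap_spinField_injective).1 (h.resolve_right (coeffAt_self p))
  · intro q _ hqp
    rw [map_smul]
    by_cases hc : coeffAt p (mFam n q) = 0
    · rw [hc, smul_zero]
    · rw [ih q ⟨prefixLE_of_coeffAt_ne_zero hc, hqp⟩, zero_smul]
  · exact fun h => absurd (Finset.mem_univ p) h

end TemperleyLieb

/-! ### Assembly of the theorem -/

theorem mainTheorem1 (n : ℕ) :
    -- the elements `m_{uv}` form a free basis of the algebra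
    (LinearIndependent (Polynomial ℤ) (TemperleyLieb.mFam n) ∧
      Submodule.span (Polynomial ℤ) (Set.range (TemperleyLieb.mFam n)) = ⊤) ∧
    -- the linear map `m_{uv} ↦ m_{vu}` exists and is the anti-involution fixing every `e_i`
    ((∃! φ : TemperleyLieb.TL n →ₗ[Polynomial ℤ] TemperleyLieb.TL n,
        ∀ (lam : TemperleyLieb.Partn n) (s t : TemperleyLieb.Tab n lam),
          φ (TemperleyLieb.m s t) = TemperleyLieb.m t s) ∧
      ∀ φ : TemperleyLieb.TL n →ₗ[Polynomial ℤ] TemperleyLieb.TL n,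
        (∀ (lam : TemperleyLieb.Partn n) (s t : TemperleyLieb.Tab n lam),
          φ (TemperleyLieb.m s t) = TemperleyLieb.m t s) ↔
        (TemperleyLieb.IsAntiInvolution φ ∧
          ∀ i : ℕ, 1 ≤ i → i < n → φ (TemperleyLieb.e n i) = TemperleyLieb.e n i)) ∧
    -- right multiplication modulo the ideal of higher shapes
    (∀ (b : TemperleyLieb.TL n) (lam : TemperleyLieb.Partn n) (u : TemperleyLieb.Tab n lam),
      ∃ a : TemperleyLieb.Tab n lam → Polynomial ℤ, ∀ s : TemperleyLieb.Tab n lam,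
        TemperleyLieb.m s u * b - ∑ t, a t • TemperleyLieb.m s t
          ∈ TemperleyLieb.idealCheck lam) ∧
    -- that ideal is spanned by the basis elements of higher shapes
    (∀ (lam : TemperleyLieb.Partn n) (z : TemperleyLieb.TL n),
      z ∈ TemperleyLieb.idealCheck lam ↔
        z ∈ Submodule.span (Polynomial ℤ)
          {y | ∃ (mu : TemperleyLieb.Partn n) (s t : TemperleyLieb.Tab n mu),
            TemperleyLieb.SDom mu lam ∧ y = TemperleyLieb.m s t}) ∧
    -- the strengthened form of right multiplication
    (∀ (b : TemperleyLieb.TL n) (lam : TemperleyLieb.Partn n) (u : TemperleyLieb.Tab n lam),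
      ∃ (a : TemperleyLieb.Tab n lam → Polynomial ℤ)
        (c : (mu : TemperleyLieb.Partn n) → TemperleyLieb.Tab n mu → TemperleyLieb.Tab n mu →
          Polynomial ℤ),
        (∀ (mu : TemperleyLieb.Partn n) (r t : TemperleyLieb.Tab n mu), c mu r t ≠ 0 →
          TemperleyLieb.SDom mu lam ∧ r ∈ TemperleyLieb.tabAbove lam.1.1 mu) ∧
        TemperleyLieb.mShape lam * TemperleyLieb.v u * b =
          ∑ t, a t • (TemperleyLieb.mShape lam * TemperleyLieb.v t) +
          ∑ mu, ∑ r, ∑ t, c mu r t • TemperleyLieb.m (lam := mu) r t) := by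
  -- Since the `m_{st}` span, a linear map exchanging the two tableaux must be `tlStar n`; existence
  -- needs no appeal to freeness.
  have hstar : ∀ φ : TemperleyLieb.TL n →ₗ[Polynomial ℤ] TemperleyLieb.TL n,
      (∀ (lam : TemperleyLieb.Partn n) (s t : TemperleyLieb.Tab n lam),
        φ (TemperleyLieb.m s t) = TemperleyLieb.m t s) → φ = TemperleyLieb.tlStar n := by
    intro φ hφ
    refine LinearMap.ext_on_range (TemperleyLieb.span_mFam n) fun p => ?_
    exact (hφ p.1 p.2.1 p.2.2).trans (TemperleyLieb.tlStar_m p.2.1 p.2.2).symm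
  refine ⟨⟨TemperleyLieb.linearIndependent_mFam n, TemperleyLieb.span_mFam n⟩,
    ⟨⟨TemperleyLieb.tlStar n, fun _ => TemperleyLieb.tlStar_m, hstar⟩, fun φ => ⟨fun hφ => ?_, ?_⟩⟩,
    TemperleyLieb.exists_m_mul_sub_mem, TemperleyLieb.mem_idealCheck_iff,
    TemperleyLieb.exists_mShape_mul_v_mul_eq⟩
  · rw [hstar φ hφ]
    exact ⟨TemperleyLieb.isAntiInvolution_tlStar n, fun i _ _ => TemperleyLieb.tlStar_e i⟩
  · rintro ⟨hφ, he⟩ lam s t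
    rw [hφ.eq_tlStar he, TemperleyLieb.tlStar_m]
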